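/- An infinite binary image is a coloring $I$ of $\mathbb{Z}^2$ with the two colors black and white; its white pixel density is $$\rho(I) := \liminf_{j\to\infty,\ j \text{ odd}} \frac{\#\{\text{white pixels of } I \text{ in the } j\times j \text{ box centered at the origin}\}}{j^2}.$$ Two pixels $x,y\in\mathbb{Z}^2$ are $4$-adjacent if $|x_1-y_1|+|x_2-y_2|=1$, and $8$-adjacent if $\max\{|x_1-y_1|,|x_2-y_2|\}=1$. For $\alpha\in\{4,8\}$, the white $\alpha$-connected components of $I$ are the connected components of the graph of $\alpha$-adjacency on the white pixels of $I$. For $k \in \mathbb{N}=\{1,2,3,\dots\}$, let $\Phi_\alpha(k)$ be the supremum of $\rho(I)$ over all infinite binary images $I$ whose white $\alpha$-connected components all have size at most $k$. For $n\in\mathbb{N}$ put $s_0(n) := (n-1)^2+n^2$, $s_1(n) := n(2n-1)$, $s_2(n) := 2n^2$, $s_3(n) := n(2n+1)$, and let $$\mathcal{S} := \mathbb{N}\cap\bigcup_{n=1}^\infty \Big(\Big[s_0(n)-\tfrac{n}{2},\, s_0(n)+\tfrac{n-1}{2}\Big] \cup \Big[s_2(n)-\tfrac{n}{2},\, s_2(n)+\tfrac{n}{2}\Big]\Big),$$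 $$\mathcal{U} := \mathbb{N}_{\ge 2}\cap\bigcup_{n=1}^\infty \Big(\Big[s_1(n),\, s_1(n)+\tfrac{n-1}{2}\Big] \cup \Big[s_3(n),\, s_3(n)+\tfrac{n}{2}\Big]\Big).$$ Then for all $k\in\mathbb{N}$, $$\Phi_8(k) = F_8(k) := \max_{1\le j\le k} \frac{j}{j+\lceil 2\sqrt{j}\,\rceil+1}, \qquad \Phi_4(k) \le F_4(k) := \max_{1\le j\le k} \frac{j}{j+\frac12\lceil 2\sqrt{2j-1}\,\rceil}.$$ Moreover $\Phi_4(k)=F_4(k)$ for all $k\in\mathcal{S}$, and $\Phi_4(k)<F_4(k)$ for all $k\in\mathcal{U}$. The set $\mathcal{S}$ has natural density $\frac12$, that is, $\lim_{N\to\infty} \#(\mathcal{S}\cap\{1,\dots,N\})/N = \frac12$. -/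

import Mathlib

noncomputable section

namespace WhiteDensity

/-- The two colours of a pixel. -/
inductive Color : Type
  | black
  | white

/-- An infinite binary image: a colouring of `ℤ²`. -/
abbrev Image : Type := ℤ × ℤ → Color

/-- The set of white pixels of an image. -/
def whitePixels (I : Image) : Set (ℤ × ℤ) := {p | I p = Color.white}

/-- The `j × j` box centred at the origin, with `j = 2 * m + 1` odd. -/
def box (m : ℕ) : Set (ℤ × ℤ) :=
  Set.Icc (-(m : ℤ)) (m : ℤ) ×ˢ Set.Icc (-(m : ℤ)) (m : ℤ)

/-- The white pixel density: the lower limit, over odd `j = 2 * m + 1`, of the proportion of white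
pixels in the `j × j` box centred at the origin. -/
def density (I : Image) : ℝ :=
  Filter.liminf
    (fun m : ℕ => ((whitePixels I ∩ box m).ncard : ℝ) / (2 * (m : ℝ) + 1) ^ 2) Filter.atTop

/-- The `ℓ¹` metric on `ℤ²`. -/
def d4 (x y : ℤ × ℤ) : ℤ := |x.1 - y.1| + |x.2 - y.2|

/-- The `ℓ^∞` metric on `ℤ²`. -/
def d8 (x y : ℤ × ℤ) : ℤ := max |x.1 - y.1| |x.2 - y.2|

/-- The graph of 4-adjacency on `ℤ²`. -/
def grid4 : SimpleGraph (ℤ × ℤ) where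
  Adj x y := d4 x y = 1
  symm := ⟨fun x y h => by
    simpa only [d4, abs_sub_comm y.1 x.1, abs_sub_comm y.2 x.2] using h⟩
  loopless := ⟨fun x h => by simp [d4] at h⟩

/-- The graph of 8-adjacency on `ℤ²`. -/
def grid8 : SimpleGraph (ℤ × ℤ) where
  Adj x y := d8 x y = 1
  symm := ⟨fun x y h => by
    simpa only [d8, abs_sub_comm y.1 x.1, abs_sub_comm y.2 x.2] using h⟩
  loopless := ⟨fun x h => by simp [d8] at h⟩

/-- Every white connected component of `I`, for the adjacency graph `G`, has at most `k` pixels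
(in particular, it is finite). -/
def WhiteComponentsLE (G : SimpleGraph (ℤ × ℤ)) (k : ℕ) (I : Image) : Prop :=
  ∀ C : (G.induce (whitePixels I)).ConnectedComponent, C.supp.encard ≤ (k : ℕ∞)

/-- The supremal white pixel density of an infinite image whose white connected components
have size at most `k`. -/
def Phi (G : SimpleGraph (ℤ × ℤ)) (k : ℕ) : ℝ :=
  sSup {r : ℝ | ∃ I : Image, WhiteComponentsLE G k I ∧ density I = r}

/-- `Φ₄(k)`. -/
def Phi4 (k : ℕ) : ℝ := Phi grid4 k

/-- `Φ₈(k)`. -/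
def Phi8 (k : ℕ) : ℝ := Phi grid8 k

/-- `F₄(k)`, the maximum over `1 ≤ j ≤ k` of `j / (j + ⌈2 √(2 j - 1)⌉ / 2)`. -/
def F4 (k : ℕ) (hk : 1 ≤ k) : ℝ :=
  (Finset.Icc 1 k).sup' (Finset.nonempty_Icc.2 hk)
    (fun j : ℕ => (j : ℝ) / ((j : ℝ) + (⌈2 * Real.sqrt (2 * (j : ℝ) - 1)⌉ : ℝ) / 2))

/-- `F₈(k)`, the maximum over `1 ≤ j ≤ k` of `j / (j + ⌈2 √j⌉ + 1)`. -/
def F8 (k : ℕ) (hk : 1 ≤ k) : ℝ :=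
  (Finset.Icc 1 k).sup' (Finset.nonempty_Icc.2 hk)
    (fun j : ℕ => (j : ℝ) / ((j : ℝ) + (⌈2 * Real.sqrt (j : ℝ)⌉ : ℝ) + 1))

/-- `s₀(n) = (n - 1)² + n²`. -/
def s0 (n : ℕ) : ℝ := ((n : ℝ) - 1) ^ 2 + (n : ℝ) ^ 2

/-- `s₁(n) = n (2 n - 1)`. -/
def s1 (n : ℕ) : ℝ := (n : ℝ) * (2 * (n : ℝ) - 1)

/-- `s₂(n) = 2 n²`. -/
def s2 (n : ℕ) : ℝ := 2 * (n : ℝ) ^ 2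

/-- `s₃(n) = n (2 n + 1)`. -/
def s3 (n : ℕ) : ℝ := (n : ℝ) * (2 * (n : ℝ) + 1)

/-- The set `𝒮`. -/
def setS : Set ℕ :=
  {k | 1 ≤ k ∧ ∃ n : ℕ, 1 ≤ n ∧
    ((k : ℝ) ∈ Set.Icc (s0 n - (n : ℝ) / 2) (s0 n + ((n : ℝ) - 1) / 2) ∨
      (k : ℝ) ∈ Set.Icc (s2 n - (n : ℝ) / 2) (s2 n + (n : ℝ) / 2))}

/-- The set `𝒰`. -/
def setU : Set ℕ :=
  {k | 2 ≤ k ∧ ∃ n : ℕ, 1 ≤ n ∧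
    ((k : ℝ) ∈ Set.Icc (s1 n) (s1 n + ((n : ℝ) - 1) / 2) ∨
      (k : ℝ) ∈ Set.Icc (s3 n) (s3 n + (n : ℝ) / 2))}

/-- The set `A` of positive integers has natural density `d`. -/
def HasNaturalDensity (A : Set ℕ) (d : ℝ) : Prop :=
  Filter.Tendsto (fun N : ℕ => ((A ∩ Set.Icc 1 N).ncard : ℝ) / (N : ℝ)) Filter.atTop (nhds d)

end WhiteDensity

end

noncomputable section

namespace WhiteDensity

open Finset

/-! Upper bounds. White pixels are charged to unit cells, the cell `z` having the corners `z`, `z +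
(1, 0)`, `z + (0, 1)`, `z + (1, 1)`. If every component `C` puts total weight at least `|C| / μ` on
the cells and no cell carries more than `β`, the density is at most `μ β` (`white_count_le`). For
8-adjacency a component has weight one on each cell it meets; the corners of a cell are pairwise
adjacent, so `β = 1`. A component meeting `p` columns and `q` rows meets at least `|C| + p + q + 1`
cells, and `|C| ≤ p q` gives `p + q ≥ ⌈2√|C|⌉`. For 4-adjacency the weight is the number of
diagonals of the cell that meet `C`, and `β = 2`. If `C` meets `p` lines `x + y = const` and `q`
lines `x - y = const`, its total weight is at least `2|C| + p + q`, and `2|C| ≤ p q + 1` by a parity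
count.

Sharpness comes from lattice-periodic images. For 8-adjacency a rectangle with a partial extra row
works for every size. For 4-adjacency the tile is an odd by odd rotated box with `i` pixels removed
from an extreme diagonal, paired with a point reflection that shares these `i` black pixels
(`le_Phi4_of_notchedBox`). It realises the sizes `s₀(n) - i` and `s₂(n) - i` for small `i`, and for
`k` in `𝒮` one of these sizes attains `F4`.

For `k` in `𝒰`, the best ratio is attained only by full rotated boxes with sides `e = 2n` and `o =
2n ± 1`, and a lossless image has no cell with fewer than two white pixels. Such boxes do not fit
together even locally (`LocallyTiled.not_white`), so every window of a fixed radius contains a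
defect, and defects of positive frequency cost a fixed amount of density
(`exists_lt_forall_density_le`). -/

/-- `C` is the set of pixels of a white connected component of `I`. -/
def IsWhiteComponent (G : SimpleGraph (ℤ × ℤ)) (I : Image) (C : Finset (ℤ × ℤ)) : Prop :=
  ∃ K : (G.induce (whitePixels I)).ConnectedComponent, (C : Set (ℤ × ℤ)) = Subtype.val '' K.supp

/-! ### White components as finite sets -/

section Components

variable {G : SimpleGraph (ℤ × ℤ)} {I : Image} {k : ℕ} {C D : Finset (ℤ × ℤ)} {x y : ℤ × ℤ}

theorem exists_isWhiteComponent (hI : WhiteComponentsLE G k I) (hx : x ∈ whitePixels I) :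
    ∃ C, IsWhiteComponent G I C ∧ x ∈ C := by
  set K := (G.induce (whitePixels I)).connectedComponentMk ⟨x, hx⟩
  have hfin : K.supp.Finite := Set.finite_of_encard_le_coe (hI K)
  refine ⟨(hfin.image Subtype.val).toFinset, ⟨K, by simp⟩, ?_⟩
  simp only [Set.Finite.mem_toFinset]
  exact ⟨⟨x, hx⟩, rfl, rfl⟩

theorem IsWhiteComponent.mem_white (hC : IsWhiteComponent G I C) (hx : x ∈ C) :
    x ∈ whitePixels I := by
  obtain ⟨K, hK⟩ := hC
  have : x ∈ (C : Set (ℤ × ℤ)) := hx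
  rw [hK] at this
  obtain ⟨⟨z, hz⟩, -, rfl⟩ := this
  exact hz

theorem IsWhiteComponent.card_le (hI : WhiteComponentsLE G k I) (hC : IsWhiteComponent G I C) :
    C.card ≤ k := by
  obtain ⟨K, hK⟩ := hC
  have h := hI K
  rw [← Subtype.val_injective.encard_image, ← hK, Set.encard_coe_eq_coe_finsetCard] at h
  exact_mod_cast h

theorem IsWhiteComponent.nonempty (hC : IsWhiteComponent G I C) : C.Nonempty := by
  obtain ⟨K, hK⟩ := hC
  rw [← Finset.coe_nonempty, hK]
  exact K.nonempty_supp.image _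

theorem IsWhiteComponent.eq_of_mem (hC : IsWhiteComponent G I C) (hD : IsWhiteComponent G I D)
    (hxC : x ∈ C) (hxD : x ∈ D) : C = D := by
  obtain ⟨K, hK⟩ := hC
  obtain ⟨L, hL⟩ := hD
  have h1 : x ∈ (C : Set (ℤ × ℤ)) := hxC
  have h2 : x ∈ (D : Set (ℤ × ℤ)) := hxD
  rw [hK] at h1
  rw [hL] at h2
  obtain ⟨a, ha, rfl⟩ := h1
  obtain ⟨b, hb, hab⟩ := h2
  obtain rfl : b = a := Subtype.ext hab
  have : K = L := by
    rw [SimpleGraph.ConnectedComponent.mem_supp_iff] at ha hb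
    rw [← ha, ← hb]
  subst this
  exact Finset.coe_injective (hK.trans hL.symm)

theorem IsWhiteComponent.mem_of_adj (hC : IsWhiteComponent G I C) (hx : x ∈ C)
    (hy : y ∈ whitePixels I) (h : G.Adj x y) : y ∈ C := by
  obtain ⟨K, hK⟩ := hC
  have h1 : x ∈ (C : Set (ℤ × ℤ)) := hx
  rw [hK] at h1
  obtain ⟨a, ha, rfl⟩ := h1
  suffices y ∈ (C : Set (ℤ × ℤ)) from this
  rw [hK]
  refine ⟨⟨y, hy⟩, ?_, rfl⟩
  exact SimpleGraph.ConnectedComponent.mem_supp_of_adj_mem_supp K ha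
    (by simpa [SimpleGraph.comap_adj] using h)

theorem IsWhiteComponent.eq_of_adj (hC : IsWhiteComponent G I C) (hD : IsWhiteComponent G I D)
    (hx : x ∈ C) (hy : y ∈ D) (h : G.Adj x y) : C = D :=
  hC.eq_of_mem hD (hC.mem_of_adj hx (hD.mem_white hy) h) hy

/-- A discrete intermediate value theorem on a white component. -/
theorem IsWhiteComponent.exists_eq_of_le (hC : IsWhiteComponent G I C) (f : ℤ × ℤ → ℤ)
    (hf : ∀ x y, G.Adj x y → |f x - f y| ≤ 1) (hx : x ∈ C) (hy : y ∈ C) {c : ℤ}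
    (hxc : f x ≤ c) (hcy : c ≤ f y) : ∃ z ∈ C, f z = c := by
  have key : ∀ a b : whitePixels I, (G.induce (whitePixels I)).Walk a b → (a : ℤ × ℤ) ∈ C →
      f a ≤ c → c ≤ f b → ∃ z ∈ C, f z = c := by
    intro a b w
    induction w with
    | nil => intro h h1 h2; exact ⟨_, h, le_antisymm h1 h2⟩
    | @cons a b d hab w ih =>
      intro h h1 h2
      by_cases hac : f a = c
      · exact ⟨_, h, hac⟩
      · have hadj : G.Adj a b := by simpa [SimpleGraph.comap_adj] using hab
        have := abs_le.1 (hf _ _ hadj)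
        exact ih (hC.mem_of_adj h b.2 hadj) (by omega) h2
  have hxw := hC.mem_white hx
  have hyw := hC.mem_white hy
  have hreach : (G.induce (whitePixels I)).Reachable ⟨x, hxw⟩ ⟨y, hyw⟩ := by
    obtain ⟨K, hK⟩ := hC
    have h1 : x ∈ (C : Set (ℤ × ℤ)) := hx
    have h2 : y ∈ (C : Set (ℤ × ℤ)) := hy
    rw [hK] at h1 h2
    obtain ⟨a, ha, rfl⟩ := h1
    obtain ⟨b, hb, rfl⟩ := h2
    exact SimpleGraph.ConnectedComponent.exact (ha.trans hb.symm)
  obtain ⟨w⟩ := hreach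
  exact key _ _ w hx hxc hcy

theorem IsWhiteComponent.image_eq_Icc (hC : IsWhiteComponent G I C) (f : ℤ × ℤ → ℤ)
    (hf : ∀ x y, G.Adj x y → |f x - f y| ≤ 1) :
    ∃ a b, a ≤ b ∧ C.image f = Finset.Icc a b := by
  have hne : (C.image f).Nonempty := hC.nonempty.image f
  refine ⟨(C.image f).min' hne, (C.image f).max' hne, Finset.min'_le_max' _ _, ?_⟩
  ext c
  rw [Finset.mem_Icc]
  constructor
  · exact fun h => ⟨Finset.min'_le _ _ h, Finset.le_max' _ _ h⟩
  · rintro ⟨h1, h2⟩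
    obtain ⟨x, hx, hxe⟩ := Finset.mem_image.1 ((C.image f).min'_mem hne)
    obtain ⟨y, hy, hye⟩ := Finset.mem_image.1 ((C.image f).max'_mem hne)
    rw [← hxe] at h1
    rw [← hye] at h2
    obtain ⟨z, hz, rfl⟩ := hC.exists_eq_of_le f hf hx hy h1 h2
    exact Finset.mem_image_of_mem f hz

/-- The values of `f` on a component form an interval with at most `k` elements. Applied to the
coordinates, this keeps the components that meet a box close to it. -/
theorem IsWhiteComponent.sub_lt (hI : WhiteComponentsLE G k I) (hC : IsWhiteComponent G I C)
    (f : ℤ × ℤ → ℤ) (hf : ∀ x y, G.Adj x y → |f x - f y| ≤ 1) (hx : x ∈ C) (hy : y ∈ C) :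
    f y - f x < k := by
  obtain ⟨a, b, -, hab⟩ := hC.image_eq_Icc f hf
  have h1 : f x ∈ Finset.Icc a b := hab ▸ Finset.mem_image_of_mem f hx
  have h2 : f y ∈ Finset.Icc a b := hab ▸ Finset.mem_image_of_mem f hy
  have h3 : (Finset.Icc a b).card ≤ k := hab ▸ Finset.card_image_le.trans (hC.card_le hI)
  rw [Int.card_Icc] at h3
  rw [Finset.mem_Icc] at h1 h2
  omega

end Components

/-! ### Counting in boxes and density -/

/-- The centred box as a finset. -/
def boxF (m : ℕ) : Finset (ℤ × ℤ) :=
  Finset.Icc (-(m : ℤ)) m ×ˢ Finset.Icc (-(m : ℤ)) m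

theorem mem_boxF {m : ℕ} {z : ℤ × ℤ} :
    z ∈ boxF m ↔ (-(m : ℤ) ≤ z.1 ∧ z.1 ≤ m) ∧ (-(m : ℤ) ≤ z.2 ∧ z.2 ≤ m) := by
  simp [boxF]

theorem card_boxF (m : ℕ) : (boxF m).card = (2 * m + 1) ^ 2 := by
  rw [boxF, Finset.card_product, Int.card_Icc, sq]
  congr 1 <;> omega

open Classical in
theorem ncard_inter_box (A : Set (ℤ × ℤ)) (m : ℕ) :
    (A ∩ box m).ncard = ((boxF m).filter (· ∈ A)).card := by
  rw [← Set.ncard_coe_finset]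
  congr 1
  ext z
  simp only [box, boxF, Finset.coe_filter, Set.mem_inter_iff, Set.mem_prod, Set.mem_Icc,
    Finset.mem_product, Finset.mem_Icc, Set.mem_ofPred_eq]
  tauto

open Classical in
/-- The weighted counting bound: if every white component carries, on the unit cells it meets, a
weight proportional to its size, and the total weight of a cell is bounded, then the number of
white pixels is bounded. The sets `D` and `E` record where these bounds are not sharp. -/
theorem white_count_le {G : SimpleGraph (ℤ × ℤ)} {I : Image} {k : ℕ}
    (hG : ∀ x y, G.Adj x y → |x.1 - y.1| ≤ 1 ∧ |x.2 - y.2| ≤ 1)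
    (hI : WhiteComponentsLE G k I) (ω : Finset (ℤ × ℤ) → ℤ × ℤ → ℕ) (D E : Set (ℤ × ℤ))
    {δ μ β : ℝ} (hδ : 0 ≤ δ) (hδμ : δ ≤ μ) (hDW : D ⊆ whitePixels I)
    (hcomp : ∀ C, IsWhiteComponent G I C → ∀ S : Finset (ℤ × ℤ),
      (∀ p ∈ C, Finset.Icc (p.1 - 1) p.1 ×ˢ Finset.Icc (p.2 - 1) p.2 ⊆ S) →
      (C.card : ℝ) + δ * ((C.filter (· ∈ D)).card : ℝ) ≤ μ * ∑ z ∈ S, (ω C z : ℝ))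
    (hcell : ∀ 𝒞 : Finset (Finset (ℤ × ℤ)), (∀ C ∈ 𝒞, IsWhiteComponent G I C) → ∀ z,
      (∑ C ∈ 𝒞, (ω C z : ℝ)) + (if z ∈ E then 1 else 0) ≤ β) (m : ℕ) :
    (((boxF m).filter (· ∈ whitePixels I)).card : ℝ) +
      δ * ((((boxF m).filter (· ∈ D)).card : ℝ) + (((boxF m).filter (· ∈ E)).card : ℝ)) ≤
      μ * β * (2 * ((m : ℝ) + k) + 3) ^ 2 := by
  have hμ : 0 ≤ μ := hδ.trans hδμ
  choose! comp hcompw hcompm using fun x (hx : x ∈ whitePixels I) => exists_isWhiteComponent hI hx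
  set 𝒞 : Finset (Finset (ℤ × ℤ)) := ((boxF m).filter (· ∈ whitePixels I)).image comp with h𝒞
  have h𝒞w : ∀ C ∈ 𝒞, IsWhiteComponent G I C := by
    intro C hC
    obtain ⟨x, hx, rfl⟩ := Finset.mem_image.1 hC
    exact hcompw x (Finset.mem_filter.1 hx).2
  have hdisj : (𝒞 : Set (Finset (ℤ × ℤ))).PairwiseDisjoint id := by
    intro C hC C' hC' hne
    rw [Function.onFun, id, id, Finset.disjoint_left]
    exact fun x hx hx' => hne ((h𝒞w C hC).eq_of_mem (h𝒞w C' hC') hx hx')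
  -- A component that meets the box reaches less than `k` beyond it, and its cells have their lower
  -- left corners at most one unit further.
  set B := boxF (m + k + 1)
  have hsupp : ∀ C ∈ 𝒞, ∀ p ∈ C, Finset.Icc (p.1 - 1) p.1 ×ˢ Finset.Icc (p.2 - 1) p.2 ⊆ B := by
    intro C hC p hp z hz
    obtain ⟨x, hx, rfl⟩ := Finset.mem_image.1 hC
    obtain ⟨hxb, hxw⟩ := Finset.mem_filter.1 hx
    rw [mem_boxF] at hxb
    have hw := hcompw x hxw
    have hm := hcompm x hxw
    have a1 := hw.sub_lt hI Prod.fst (fun a b h => (hG a b h).1) hm hp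
    have a2 := hw.sub_lt hI Prod.fst (fun a b h => (hG a b h).1) hp hm
    have a3 := hw.sub_lt hI Prod.snd (fun a b h => (hG a b h).2) hm hp
    have a4 := hw.sub_lt hI Prod.snd (fun a b h => (hG a b h).2) hp hm
    rw [Finset.mem_product, Finset.mem_Icc, Finset.mem_Icc] at hz
    rw [mem_boxF]
    push_cast
    omega
  have h1 : (((boxF m).filter (· ∈ whitePixels I)).card : ℝ) ≤ ∑ C ∈ 𝒞, (C.card : ℝ) := by
    have hb := Finset.card_biUnion (s := 𝒞) (t := id) (fun C hC C' hC' h => hdisj hC hC' h)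
    simp only [id] at hb
    rw [← Nat.cast_sum, ← hb]
    refine Nat.cast_le.2 (Finset.card_le_card fun x hx => ?_)
    exact Finset.mem_biUnion.2
      ⟨comp x, Finset.mem_image_of_mem _ hx, hcompm x (Finset.mem_filter.1 hx).2⟩
  have h2 : (((boxF m).filter (· ∈ D)).card : ℝ) ≤
      ∑ C ∈ 𝒞, ((C.filter (· ∈ D)).card : ℝ) := by
    rw [← Nat.cast_sum, ← Finset.card_biUnion (s := 𝒞) (t := fun C => C.filter (· ∈ D))]
    · refine Nat.cast_le.2 (Finset.card_le_card fun x hx => ?_)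
      obtain ⟨hxb, hxD⟩ := Finset.mem_filter.1 hx
      refine Finset.mem_biUnion.2 ⟨comp x, Finset.mem_image_of_mem _ ?_, ?_⟩
      · exact Finset.mem_filter.2 ⟨hxb, hDW hxD⟩
      · exact Finset.mem_filter.2 ⟨hcompm x (hDW hxD), hxD⟩
    · intro C hC C' hC' h
      exact Finset.disjoint_filter_filter (hdisj hC hC' h)
  have h3 : (((boxF m).filter (· ∈ E)).card : ℝ) ≤ ∑ z ∈ B, (if z ∈ E then (1 : ℝ) else 0) := by
    rw [Finset.sum_boole]
    refine Nat.cast_le.2 (Finset.card_le_card (Finset.filter_subset_filter _ fun z hz => ?_))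
    rw [mem_boxF] at hz ⊢
    push_cast
    omega
  have h4 : ∑ C ∈ 𝒞, ((C.card : ℝ) + δ * ((C.filter (· ∈ D)).card : ℝ)) ≤
      ∑ C ∈ 𝒞, μ * ∑ z ∈ B, (ω C z : ℝ) :=
    Finset.sum_le_sum fun C hC => hcomp C (h𝒞w C hC) B (hsupp C hC)
  have h5 : ∑ z ∈ B, ((∑ C ∈ 𝒞, (ω C z : ℝ)) + (if z ∈ E then 1 else 0)) ≤ ∑ _z ∈ B, β :=
    Finset.sum_le_sum fun z _ => hcell 𝒞 h𝒞w z
  rw [Finset.sum_const, card_boxF, nsmul_eq_mul, Finset.sum_add_distrib, Finset.sum_comm] at h5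
  rw [Finset.sum_add_distrib, ← Finset.mul_sum, ← Finset.mul_sum] at h4
  have h6 := mul_le_mul_of_nonneg_left h5 hμ
  have h7 := mul_le_mul_of_nonneg_left h2 hδ
  -- The slack on cells of `E` is worth `μ` per cell; since `δ ≤ μ` it can be recorded at the rate
  -- `δ`.
  have h8 : δ * (((boxF m).filter (· ∈ E)).card : ℝ) ≤
      μ * ∑ z ∈ B, (if z ∈ E then (1 : ℝ) else 0) :=
    mul_le_mul hδμ h3 (Nat.cast_nonneg _) hμ
  push_cast at h6
  have h9 : μ * ((2 * ((m : ℝ) + k + 1) + 1) ^ 2 * β) = μ * β * (2 * ((m : ℝ) + k) + 3) ^ 2 := by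
    ring
  rw [h9, mul_add] at h6
  linarith

/-- A uniform bound on the numbers of white pixels in boxes bounds the density. -/
theorem density_le_of_tendsto {I : Image} {v : ℕ → ℝ} {θ : ℝ}
    (hv : ∀ᶠ m : ℕ in Filter.atTop,
      ((whitePixels I ∩ box m).ncard : ℝ) / (2 * (m : ℝ) + 1) ^ 2 ≤ v m)
    (hθ : Filter.Tendsto v Filter.atTop (nhds θ)) : density I ≤ θ := by
  rw [← hθ.liminf_eq]
  refine Filter.liminf_le_liminf hv ?_ ?_
  · exact Filter.isBoundedUnder_of ⟨0, fun m => by positivity⟩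
  · exact hθ.isBoundedUnder_le.isCoboundedUnder_ge

theorem tendsto_box_ratio (c : ℝ) :
    Filter.Tendsto (fun m : ℕ => (2 * (m : ℝ) + c) ^ 2 / (2 * (m : ℝ) + 1) ^ 2)
      Filter.atTop (nhds 1) := by
  have h1 : Filter.Tendsto (fun m : ℕ => (c - 1) / (2 * (m : ℝ) + 1)) Filter.atTop (nhds 0) := by
    refine Filter.Tendsto.div_atTop tendsto_const_nhds ?_
    exact Filter.tendsto_atTop_add_const_right _ _
      (tendsto_natCast_atTop_atTop.const_mul_atTop (by norm_num))
  have h2 := ((h1.const_add 1).pow 2)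
  rw [show ((1 : ℝ) + 0) ^ 2 = 1 by norm_num] at h2
  refine h2.congr fun m => ?_
  have : (2 * (m : ℝ) + 1) ≠ 0 := by positivity
  field_simp
  ring

theorem density_le_of_count {I : Image} {θ c : ℝ}
    (h : ∀ m : ℕ, ((whitePixels I ∩ box m).ncard : ℝ) ≤ θ * (2 * (m : ℝ) + c) ^ 2) :
    density I ≤ θ := by
  have := (tendsto_box_ratio c).const_mul θ
  rw [mul_one] at this
  refine density_le_of_tendsto (Filter.Eventually.of_forall fun m => ?_) this
  rw [← mul_div_assoc]
  exact div_le_div_of_nonneg_right (h m) (by positivity)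

open Classical in
/-- If `D ∪ E` meets every box of radius `R`, the sharper count bound gives a strictly smaller
density bound. -/
theorem density_le_of_count_of_dense {I : Image} {D E : Set (ℤ × ℤ)} {θ c δ : ℝ} {R : ℕ}
    (hδ : 0 ≤ δ)
    (h : ∀ m : ℕ, (((boxF m).filter (· ∈ whitePixels I)).card : ℝ) +
      δ * ((((boxF m).filter (· ∈ D)).card : ℝ) + (((boxF m).filter (· ∈ E)).card : ℝ)) ≤
      θ * (2 * (m : ℝ) + c) ^ 2)
    (hR : ∀ z : ℤ × ℤ, ∃ y, y ∈ D ∪ E ∧ |y.1 - z.1| ≤ R ∧ |y.2 - z.2| ≤ R) :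
    density I ≤ θ - δ / (2 * (R : ℝ) + 1) ^ 2 := by
  have ht := ((tendsto_box_ratio c).const_mul θ).sub
    ((tendsto_box_ratio (1 - 2 * R)).const_mul (δ / (2 * (R : ℝ) + 1) ^ 2))
  rw [mul_one, mul_one] at ht
  refine density_le_of_tendsto ?_ ht
  filter_upwards [Filter.eventually_ge_atTop R] with m hm
  rw [ncard_inter_box, ← mul_div_assoc, ← mul_div_assoc, ← sub_div]
  refine div_le_div_of_nonneg_right ?_ (by positivity)
  obtain ⟨l, rfl⟩ := Nat.exists_eq_add_of_le hm
  -- The points of `D ∪ E` near the box of radius `l` all lie in the box of radius `R + l`, and each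
  -- serves at most `(2R + 1)²` pixels.
  have hcover : boxF l ⊆ (((boxF (R + l)).filter (· ∈ D)) ∪ ((boxF (R + l)).filter (· ∈ E))).biUnion
      fun y => (boxF R).image fun t => y + t := by
    intro z hz
    obtain ⟨y, hy, h1, h2⟩ := hR z
    rw [abs_le] at h1 h2
    rw [mem_boxF] at hz
    have hyb : y ∈ boxF (R + l) := by
      rw [mem_boxF]; push_cast; omega
    refine Finset.mem_biUnion.2 ⟨y, ?_, Finset.mem_image.2 ⟨z - y, ?_, by simp⟩⟩
    · rw [← Finset.filter_or]
      exact Finset.mem_filter.2 ⟨hyb, hy⟩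
    · rw [mem_boxF]
      simp only [Prod.fst_sub, Prod.snd_sub]
      omega
  have hcard := (Finset.card_le_card hcover).trans
    (Finset.card_biUnion_le_card_mul _ _ ((2 * R + 1) ^ 2)
      fun y _ => Finset.card_image_le.trans (card_boxF R).le)
  have hcard2 := hcard.trans (Nat.mul_le_mul_right _ (Finset.card_union_le _ _))
  rw [card_boxF] at hcard2
  have hcard3 : (2 * (l : ℝ) + 1) ^ 2 ≤ ((((boxF (R + l)).filter (· ∈ D)).card : ℝ) +
      (((boxF (R + l)).filter (· ∈ E)).card : ℝ)) * (2 * (R : ℝ) + 1) ^ 2 := by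
    exact_mod_cast hcard2
  have hpos : (0 : ℝ) < (2 * (R : ℝ) + 1) ^ 2 := by positivity
  have h4 : δ / (2 * (R : ℝ) + 1) ^ 2 * (2 * (l : ℝ) + 1) ^ 2 ≤
      δ * ((((boxF (R + l)).filter (· ∈ D)).card : ℝ) +
      (((boxF (R + l)).filter (· ∈ E)).card : ℝ)) := by
    rw [div_mul_eq_mul_div, div_le_iff₀ hpos, mul_assoc]
    exact mul_le_mul_of_nonneg_left hcard3 hδ
  have h5 := h (R + l)
  push_cast at h5 ⊢
  have h6 : 2 * ((R : ℝ) + l) + (1 - 2 * R) = 2 * l + 1 := by ring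
  rw [h6]
  linarith

/-! ### Isoperimetric bounds for the weights -/

/-- Adding one translate adds at least one point on every line that is met. -/
theorem card_add_card_image_le_card_union_translate (C : Finset (ℤ × ℤ)) (e : ℤ × ℤ)
    (f g : ℤ × ℤ → ℤ) (hf : ∀ z, f (z - e) = f z) (hg : ∀ z, g (z - e) < g z) :
    C.card + (C.image f).card ≤ (C ∪ C.image (· - e)).card := by
  rw [← Finset.union_sdiff_self_eq_union, Finset.card_union_of_disjoint Finset.disjoint_sdiff]
  refine Nat.add_le_add_left (le_trans (Finset.card_le_card ?_)
    (Finset.card_image_le (f := f))) _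
  intro c hc
  obtain ⟨x, hx, rfl⟩ := Finset.mem_image.1 hc
  -- Translating the `g`-smallest point of `C` on a line stays on that line and leaves `C`.
  obtain ⟨z, hz, hmin⟩ := Finset.exists_min_image (C.filter fun y => f y = f x) g
    ⟨x, Finset.mem_filter.2 ⟨hx, rfl⟩⟩
  obtain ⟨hzC, hzf⟩ := Finset.mem_filter.1 hz
  refine Finset.mem_image.2 ⟨z - e, Finset.mem_sdiff.2 ⟨Finset.mem_image_of_mem _ hzC, ?_⟩, ?_⟩
  · intro h
    have := hmin (z - e) (Finset.mem_filter.2 ⟨h, (hf z).trans hzf⟩)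
    exact absurd (hg z) (not_lt.2 this)
  · rw [hf, hzf]

/-- The extra column gained here is the source of the summand `1` in `F8`. -/
theorem card_image_fst_lt (C : Finset (ℤ × ℤ)) (hC : C.Nonempty) :
    (C.image Prod.fst).card < ((C ∪ C.image (· - (1, 0))).image Prod.fst).card := by
  obtain ⟨z, hz, hmin⟩ := Finset.exists_min_image C Prod.fst hC
  refine Finset.card_lt_card (Finset.ssubset_iff.2 ⟨z.1 - 1, ?_, ?_⟩)
  · intro h
    obtain ⟨y, hy, hyz⟩ := Finset.mem_image.1 h
    have := hmin y hy
    omega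
  · intro c hc
    rcases Finset.mem_insert.1 hc with rfl | hc
    · exact Finset.mem_image.2 ⟨z - (1, 0),
        Finset.mem_union_right _ (Finset.mem_image_of_mem _ hz), rfl⟩
    · exact Finset.image_subset_image Finset.subset_union_left hc

theorem card_le_card_image_mul (C : Finset (ℤ × ℤ)) :
    C.card ≤ (C.image Prod.fst).card * (C.image Prod.snd).card := by
  rw [← Finset.card_product]
  refine Finset.card_le_card fun z hz => Finset.mem_product.2 ⟨?_, ?_⟩
  · exact Finset.mem_image_of_mem _ hz
  · exact Finset.mem_image_of_mem _ hz

theorem two_mul_sqrt_le_add {p q x : ℝ} (hp : 0 ≤ p) (hq : 0 ≤ q) (h : x ≤ p * q) :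
    2 * Real.sqrt x ≤ p + q := by
  have : Real.sqrt x ≤ (p + q) / 2 := by
    rw [Real.sqrt_le_iff]
    exact ⟨by positivity, by nlinarith [sq_nonneg (p - q)]⟩
  linarith

/-- The weight of a set of pixels on a cell, for 8-adjacency. -/
def weight8 (C : Finset (ℤ × ℤ)) (z : ℤ × ℤ) : ℕ :=
  if z ∈ C ∨ z + (1, 0) ∈ C ∨ z + (0, 1) ∈ C ∨ z + (1, 1) ∈ C then 1 else 0

/-- The weight of a set of pixels on a cell, for 4-adjacency: the number of diagonals of the cell
that meet the set. -/
def weight4 (C : Finset (ℤ × ℤ)) (z : ℤ × ℤ) : ℕ :=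
  (if z ∈ C ∨ z + (1, 1) ∈ C then 1 else 0) + (if z + (1, 0) ∈ C ∨ z + (0, 1) ∈ C then 1 else 0)

/-- The cells met by `C` are indexed by `C₂ = C + {0, -1}²`. The first translation adds a pixel in
every row of `C`, the second one in every column of `C₁`, and `C₁` has more columns than `C`. -/
theorem le_sum_weight8 {C S : Finset (ℤ × ℤ)} (hC : C.Nonempty)
    (hS : ∀ p ∈ C, Finset.Icc (p.1 - 1) p.1 ×ˢ Finset.Icc (p.2 - 1) p.2 ⊆ S) :
    (C.card : ℝ) + ⌈2 * Real.sqrt C.card⌉ + 1 ≤ ∑ z ∈ S, (weight8 C z : ℝ) := by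
  set C₁ := C ∪ C.image (· - (1, 0)) with hC₁
  set C₂ := C₁ ∪ C₁.image (· - (0, 1)) with hC₂
  have h1 : C.card + (C.image Prod.snd).card ≤ C₁.card :=
    card_add_card_image_le_card_union_translate C (1, 0) Prod.snd Prod.fst (by simp) (by simp)
  have h2 : C₁.card + (C₁.image Prod.fst).card ≤ C₂.card :=
    card_add_card_image_le_card_union_translate C₁ (0, 1) Prod.fst Prod.snd (by simp) (by simp)
  have h3 := card_image_fst_lt C hC
  rw [← hC₁] at h3
  have h4 := card_le_card_image_mul C
  have h5 : C₂.card ≤ ∑ z ∈ S, weight8 C z := by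
    simp only [weight8]
    rw [Finset.sum_boole]
    refine Finset.card_le_card fun z hz => Finset.mem_filter.2 ?_
    have hz' : z ∈ C ∨ z + (1, 0) ∈ C ∨ z + (0, 1) ∈ C ∨ z + (1, 1) ∈ C := by
      have hm : ∀ y, y ∈ C₁ → y ∈ C ∨ y + (1, 0) ∈ C := by
        intro y hy
        rcases Finset.mem_union.1 hy with h | h
        · exact Or.inl h
        · obtain ⟨w, hw, rfl⟩ := Finset.mem_image.1 h
          right; simpa using hw
      rcases Finset.mem_union.1 hz with h | h
      · rcases hm z h with h | h <;> simp [h]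
      · obtain ⟨w, hw, rfl⟩ := Finset.mem_image.1 h
        rcases hm w hw with h | h
        · right; right; left; simpa using h
        · right; right; right
          convert h using 1
          ext <;> simp
    refine ⟨?_, hz'⟩
    rcases hz' with h | h | h | h <;> refine hS _ h (Finset.mem_product.2 ?_) <;> simp
  have h6 : ⌈2 * Real.sqrt C.card⌉ ≤ ((C.image Prod.fst).card + (C.image Prod.snd).card : ℤ) := by
    rw [Int.ceil_le]
    push_cast
    exact two_mul_sqrt_le_add (by positivity) (by positivity) (by exact_mod_cast h4)
  have h7 : (C.card : ℤ) + ⌈2 * Real.sqrt C.card⌉ + 1 ≤ ∑ z ∈ S, (weight8 C z : ℤ) := by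
    rw [← Nat.cast_sum]
    omega
  exact_mod_cast h7

/-- The main diagonal of the cell `z` meets `C` exactly when `z ∈ C ∪ (C - (1, 1))`, and this
translation preserves `x - y`, hence adds a pixel on every such line. The other diagonals are
treated by the translation `(1, -1)`, up to a shift by `(0, 1)`. -/
theorem le_sum_weight4 {C S : Finset (ℤ × ℤ)}
    (hS : ∀ p ∈ C, Finset.Icc (p.1 - 1) p.1 ×ˢ Finset.Icc (p.2 - 1) p.2 ⊆ S) :
    2 * C.card + (C.image fun z => z.1 + z.2).card + (C.image fun z => z.1 - z.2).card ≤
      ∑ z ∈ S, weight4 C z := by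
  have h1 : C.card + (C.image fun z => z.1 - z.2).card ≤ (C ∪ C.image (· - (1, 1))).card :=
    card_add_card_image_le_card_union_translate C (1, 1) _ Prod.fst (by simp) (by simp)
  have h2 : C.card + (C.image fun z => z.1 + z.2).card ≤ (C ∪ C.image (· - (1, -1))).card :=
    card_add_card_image_le_card_union_translate C (1, -1) _ Prod.fst
      (fun z => by simp only [Prod.fst_sub, Prod.snd_sub]; ring) (by simp)
  simp only [weight4]
  rw [Finset.sum_add_distrib, Finset.sum_boole, Finset.sum_boole]
  have h3 : (C ∪ C.image (· - (1, 1))).card ≤ (S.filter fun z => z ∈ C ∨ z + (1, 1) ∈ C).card := by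
    refine Finset.card_le_card fun z hz => Finset.mem_filter.2 ?_
    have hz' : z ∈ C ∨ z + (1, 1) ∈ C := by
      rcases Finset.mem_union.1 hz with h | h
      · exact Or.inl h
      · obtain ⟨w, hw, rfl⟩ := Finset.mem_image.1 h
        right; simpa using hw
    refine ⟨?_, hz'⟩
    rcases hz' with h | h <;> refine hS _ h (Finset.mem_product.2 ?_) <;> simp
  have h4 : (C ∪ C.image (· - (1, -1))).card ≤
      (S.filter fun z => z + (1, 0) ∈ C ∨ z + (0, 1) ∈ C).card := by
    rw [← Finset.card_image_of_injective _ (sub_left_injective (b := ((0, 1) : ℤ × ℤ)))]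
    refine Finset.card_le_card fun z hz => Finset.mem_filter.2 ?_
    have hz' : z + (1, 0) ∈ C ∨ z + (0, 1) ∈ C := by
      obtain ⟨y, hy, rfl⟩ := Finset.mem_image.1 hz
      rcases Finset.mem_union.1 hy with h | h
      · right; simpa using h
      · obtain ⟨w, hw, rfl⟩ := Finset.mem_image.1 h
        left
        convert hw using 1
        ext <;> simp
    refine ⟨?_, hz'⟩
    rcases hz' with h | h <;> refine hS _ h (Finset.mem_product.2 ?_) <;> simp
  push_cast at *
  omega

/-! ### Rotated boxes and their cardinality -/

/-- `(-1) ^ u` for an integer `u`. -/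
def paritySign (u : ℤ) : ℤ := if Even u then 1 else -1

theorem sum_paritySign (a : ℤ) (n : ℕ) :
    ∑ u ∈ Finset.Ico a (a + n), paritySign u = if Even n then 0 else paritySign a := by
  induction n with
  | zero => simp
  | succ n ih =>
    have : Finset.Ico a (a + (n + 1 : ℕ)) = insert (a + n) (Finset.Ico a (a + n)) := by
      ext x
      simp only [Finset.mem_Ico, Finset.mem_insert]
      push_cast
      omega
    rw [this, Finset.sum_insert (by simp), ih]
    by_cases hn : Even n <;> by_cases ha : Even a <;>
      simp [paritySign, hn, ha, Nat.even_add_one, Int.even_add]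

/-- The rotated box of pixels `z` with `a ≤ z.1 + z.2 ≤ b` and `c ≤ z.1 - z.2 ≤ d`. -/
def rotBox (a b c d : ℤ) : Finset (ℤ × ℤ) :=
  ((Finset.Icc a b ×ˢ Finset.Icc c d).filter fun p => Even (p.1 + p.2)).image
    fun p => ((p.1 + p.2) / 2, (p.1 - p.2) / 2)

theorem mem_rotBox {a b c d : ℤ} {z : ℤ × ℤ} :
    z ∈ rotBox a b c d ↔ (a ≤ z.1 + z.2 ∧ z.1 + z.2 ≤ b) ∧ (c ≤ z.1 - z.2 ∧ z.1 - z.2 ≤ d) := by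
  simp only [rotBox, Finset.mem_image, Finset.mem_filter, Finset.mem_product, Finset.mem_Icc]
  constructor
  · rintro ⟨⟨u, v⟩, ⟨h, r, hr⟩, rfl⟩
    simp only at *
    omega
  · intro h
    refine ⟨(z.1 + z.2, z.1 - z.2), ⟨h, ⟨z.1, by simp only; ring⟩⟩, ?_⟩
    ext <;> simp only <;> omega

/-- Pixels correspond to pairs `(u, v)` of equal parity, and twice the indicator of this is `1 +
(-1)^u (-1)^v`. The second term sums to a product of two alternating sums, so the correction to `p
q` vanishes if a side is even and is `±1` otherwise. -/
theorem two_mul_card_rotBox (a c : ℤ) (p q : ℕ) :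
    2 * ((rotBox a (a + p - 1) c (c + q - 1)).card : ℤ) =
      p * q + (if Even p then 0 else paritySign a) * (if Even q then 0 else paritySign c) := by
  have hcard : (rotBox a (a + p - 1) c (c + q - 1)).card =
      ((Finset.Ico a (a + p) ×ˢ Finset.Ico c (c + q)).filter fun p => Even (p.1 + p.2)).card := by
    have e : ∀ (s : ℤ) (n : ℕ), Finset.Icc s (s + n - 1) = Finset.Ico s (s + n) := by
      intro s n
      ext x
      simp only [Finset.mem_Icc, Finset.mem_Ico]
      omega
    rw [rotBox, e, e]
    refine Finset.card_image_of_injOn ?_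
    rintro ⟨u, v⟩ h ⟨u', v'⟩ h' heq
    obtain ⟨-, r, hr⟩ := Finset.mem_filter.1 h
    obtain ⟨-, r', hr'⟩ := Finset.mem_filter.1 h'
    simp only [Prod.mk.injEq] at *
    omega
  rw [← sum_paritySign, ← sum_paritySign, Finset.sum_mul_sum, ← Finset.sum_product', hcard,
    ← Finset.sum_boole, Finset.mul_sum]
  have hpq : (p * q : ℤ) = ∑ _x ∈ Finset.Ico a (a + p) ×ˢ Finset.Ico c (c + q), 1 := by
    simp
  rw [hpq, ← Finset.sum_add_distrib]
  refine Finset.sum_congr rfl fun x _ => ?_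
  by_cases h1 : Even x.1 <;> by_cases h2 : Even x.2 <;> simp [paritySign, h1, h2, Int.even_add]

theorem two_mul_card_rotBox_le (a c : ℤ) (p q : ℕ) :
    2 * (rotBox a (a + p - 1) c (c + q - 1)).card ≤ p * q + 1 := by
  have h := two_mul_card_rotBox a c p q
  have : (if Even p then 0 else paritySign a) * (if Even q then 0 else paritySign c) ≤ 1 := by
    simp only [paritySign]
    split_ifs <;> norm_num
  have h2 : (2 * (rotBox a (a + p - 1) c (c + q - 1)).card : ℤ) ≤ p * q + 1 := by linarith
  exact_mod_cast h2

theorem two_mul_card_rotBox_of_even (a c : ℤ) {p q : ℕ} (h : Even p ∨ Even q) :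
    2 * (rotBox a (a + p - 1) c (c + q - 1)).card = p * q := by
  have h1 := two_mul_card_rotBox a c p q
  have h2 : (2 * (rotBox a (a + p - 1) c (c + q - 1)).card : ℤ) = p * q := by
    rcases h with h | h <;> simpa [h] using h1
  exact_mod_cast h2

theorem grid4_adj {x y : ℤ × ℤ} (h : grid4.Adj x y) : |x.1 - y.1| + |x.2 - y.2| = 1 := h

theorem grid8_adj {x y : ℤ × ℤ} (h : grid8.Adj x y) : max |x.1 - y.1| |x.2 - y.2| = 1 := h

theorem grid4_abs_le (x y : ℤ × ℤ) (h : grid4.Adj x y) : |x.1 - y.1| ≤ 1 ∧ |x.2 - y.2| ≤ 1 := by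
  have := grid4_adj h
  have h1 := abs_nonneg (x.1 - y.1)
  have h2 := abs_nonneg (x.2 - y.2)
  omega

theorem grid8_abs_le (x y : ℤ × ℤ) (h : grid8.Adj x y) : |x.1 - y.1| ≤ 1 ∧ |x.2 - y.2| ≤ 1 :=
  max_le_iff.1 (grid8_adj h).le

/-- A white 4-component sits in a rotated box all of whose diagonals it meets. -/
theorem IsWhiteComponent.exists_rotBox {I : Image} {C : Finset (ℤ × ℤ)}
    (hC : IsWhiteComponent grid4 I C) :
    ∃ (a c : ℤ) (p q : ℕ), (C.image fun z => z.1 + z.2).card = p ∧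
      (C.image fun z => z.1 - z.2).card = q ∧ C ⊆ rotBox a (a + p - 1) c (c + q - 1) := by
  have hu := hC.image_eq_Icc (fun z => z.1 + z.2) (fun x y h => by
    have := grid4_adj h
    rcases abs_cases (x.1 - y.1) with h1 | h1 <;> rcases abs_cases (x.2 - y.2) with h2 | h2 <;>
      rw [abs_le] <;> omega)
  have hv := hC.image_eq_Icc (fun z => z.1 - z.2) (fun x y h => by
    have := grid4_adj h
    rcases abs_cases (x.1 - y.1) with h1 | h1 <;> rcases abs_cases (x.2 - y.2) with h2 | h2 <;>
      rw [abs_le] <;> omega)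
  obtain ⟨a, b, hab, hu⟩ := hu
  obtain ⟨c, d, hcd, hv⟩ := hv
  refine ⟨a, c, _, _, rfl, rfl, fun z hz => ?_⟩
  have h1 : z.1 + z.2 ∈ Finset.Icc a b := hu ▸ Finset.mem_image_of_mem _ hz
  have h2 : z.1 - z.2 ∈ Finset.Icc c d := hv ▸ Finset.mem_image_of_mem _ hz
  rw [hu, hv, Int.card_Icc, Int.card_Icc, mem_rotBox]
  rw [Finset.mem_Icc] at h1 h2
  omega

theorem ceil_two_mul_sqrt_le {j p q : ℕ} (h : 2 * j ≤ p * q + 1) :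
    ⌈2 * Real.sqrt (2 * (j : ℝ) - 1)⌉ ≤ (p + q : ℤ) := by
  rw [Int.ceil_le]
  push_cast
  refine two_mul_sqrt_le_add (by positivity) (by positivity) ?_
  have : (2 * (j : ℝ)) ≤ p * q + 1 := by exact_mod_cast h
  linarith

theorem IsWhiteComponent.ceil_le_sum_weight4 {I : Image} {C S : Finset (ℤ × ℤ)}
    (hC : IsWhiteComponent grid4 I C)
    (hS : ∀ p ∈ C, Finset.Icc (p.1 - 1) p.1 ×ˢ Finset.Icc (p.2 - 1) p.2 ⊆ S) :
    2 * (C.card : ℝ) + ⌈2 * Real.sqrt (2 * (C.card : ℝ) - 1)⌉ ≤ ∑ z ∈ S, (weight4 C z : ℝ) := by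
  obtain ⟨a, c, p, q, hp, hq, hsub⟩ := hC.exists_rotBox
  have h1 := le_sum_weight4 hS
  rw [hp, hq] at h1
  have h2 : 2 * C.card ≤ p * q + 1 :=
    (Nat.mul_le_mul_left 2 (Finset.card_le_card hsub)).trans (two_mul_card_rotBox_le a c p q)
  have h3 := ceil_two_mul_sqrt_le h2
  have h4 : 2 * (C.card : ℤ) + ⌈2 * Real.sqrt (2 * (C.card : ℝ) - 1)⌉ ≤
      ∑ z ∈ S, (weight4 C z : ℤ) := by
    rw [← Nat.cast_sum]
    omega
  exact_mod_cast h4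

/-! ### Total weight on a cell -/

open Classical in
theorem sum_ite_mem_le {G : SimpleGraph (ℤ × ℤ)} {I : Image} {𝒞 : Finset (Finset (ℤ × ℤ))}
    (h𝒞 : ∀ C ∈ 𝒞, IsWhiteComponent G I C) (z : ℤ × ℤ) :
    ∑ C ∈ 𝒞, (if z ∈ C then 1 else 0) ≤ if z ∈ whitePixels I then 1 else 0 := by
  rw [Finset.sum_boole]
  split_ifs with hz
  · refine Finset.card_le_one.2 fun C hC C' hC' => ?_
    obtain ⟨hC, hzC⟩ := Finset.mem_filter.1 hC
    obtain ⟨hC', hzC'⟩ := Finset.mem_filter.1 hC'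
    exact (h𝒞 C hC).eq_of_mem (h𝒞 C' hC') hzC hzC'
  · refine le_of_eq (Finset.card_eq_zero.2 (Finset.filter_eq_empty_iff.2 fun C hC h => ?_))
    exact hz ((h𝒞 C hC).mem_white h)

theorem sum_weight8_le {I : Image} {𝒞 : Finset (Finset (ℤ × ℤ))}
    (h𝒞 : ∀ C ∈ 𝒞, IsWhiteComponent grid8 I C) (z : ℤ × ℤ) : ∑ C ∈ 𝒞, weight8 C z ≤ 1 := by
  simp only [weight8]
  rw [Finset.sum_boole]
  refine Finset.card_le_one.2 fun C hC C' hC' => ?_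
  obtain ⟨hC, hzC⟩ := Finset.mem_filter.1 hC
  obtain ⟨hC', hzC'⟩ := Finset.mem_filter.1 hC'
  have key : ∀ x ∈ C, ∀ y ∈ C', (x = y ∨ grid8.Adj x y) → C = C' := by
    rintro x hx y hy (rfl | h)
    · exact (h𝒞 C hC).eq_of_mem (h𝒞 C' hC') hx hy
    · exact (h𝒞 C hC).eq_of_adj (h𝒞 C' hC') hx hy h
  rcases hzC with h | h | h | h <;> rcases hzC' with h' | h' | h' | h' <;>
    refine key _ h _ h' ?_ <;> simp [grid8, d8, Prod.ext_iff]

/-- The cells with at most one white pixel. -/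
def sparseCells (I : Image) : Set (ℤ × ℤ) :=
  {z | ∀ x y, x ∈ whitePixels I → y ∈ whitePixels I →
    (x = z ∨ x = z + (1, 0) ∨ x = z + (0, 1) ∨ x = z + (1, 1)) →
    (y = z ∨ y = z + (1, 0) ∨ y = z + (0, 1) ∨ y = z + (1, 1)) → x = y}

/-- A pixel on one diagonal of a cell is 4-adjacent to both pixels of the other. So if both
diagonals are met, a single component carries all the weight. Otherwise at most two pixels count,
each for at most one component. -/
theorem sum_weight4_le_two {I : Image} {𝒞 : Finset (Finset (ℤ × ℤ))}
    (h𝒞 : ∀ C ∈ 𝒞, IsWhiteComponent grid4 I C) (z : ℤ × ℤ) : ∑ C ∈ 𝒞, weight4 C z ≤ 2 := by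
  classical
  have hone : ∀ y, ∑ C ∈ 𝒞, (if y ∈ C then 1 else 0) ≤ 1 := fun y =>
    (sum_ite_mem_le h𝒞 y).trans (by split_ifs <;> simp)
  by_cases hanti : ∃ C ∈ 𝒞, ∃ y ∈ C, y = z + (1, 0) ∨ y = z + (0, 1)
  · by_cases hmain : ∃ C ∈ 𝒞, ∃ x ∈ C, x = z ∨ x = z + (1, 1)
    · obtain ⟨C₀, hC₀, y, hy, hyz⟩ := hanti
      obtain ⟨C₁, hC₁, x, hx, hxz⟩ := hmain
      have hmain' : ∀ C ∈ 𝒞, ∀ w ∈ C, (w = z ∨ w = z + (1, 1)) → C = C₀ := by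
        intro C hC w hw hwz
        refine (h𝒞 C hC).eq_of_adj (h𝒞 C₀ hC₀) hw hy ?_
        rcases hwz with rfl | rfl <;> rcases hyz with rfl | rfl <;> simp [grid4, d4]
      have h10 : C₁ = C₀ := hmain' C₁ hC₁ x hx hxz
      have hanti' : ∀ C ∈ 𝒞, ∀ w ∈ C, (w = z + (1, 0) ∨ w = z + (0, 1)) → C = C₀ := by
        intro C hC w hw hwz
        rw [← h10]
        refine (h𝒞 C hC).eq_of_adj (h𝒞 C₁ hC₁) hw hx ?_
        rcases hwz with rfl | rfl <;> rcases hxz with rfl | rfl <;> simp [grid4, d4]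
      rw [Finset.sum_eq_single_of_mem C₀ hC₀]
      · simp only [weight4]
        split_ifs <;> simp
      · intro C hC hne
        simp only [weight4]
        have h1 : ¬(z ∈ C ∨ z + (1, 1) ∈ C) := by
          rintro (h | h)
          · exact hne (hmain' C hC _ h (Or.inl rfl))
          · exact hne (hmain' C hC _ h (Or.inr rfl))
        have h2 : ¬(z + (1, 0) ∈ C ∨ z + (0, 1) ∈ C) := by
          rintro (h | h)
          · exact hne (hanti' C hC _ h (Or.inl rfl))
          · exact hne (hanti' C hC _ h (Or.inr rfl))
        simp only [if_neg h1, if_neg h2, add_zero]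
    · push Not at hmain
      calc ∑ C ∈ 𝒞, weight4 C z
          ≤ ∑ C ∈ 𝒞, ((if z + (1, 0) ∈ C then 1 else 0) + (if z + (0, 1) ∈ C then 1 else 0)) := by
            refine Finset.sum_le_sum fun C hC => ?_
            have h1 : z ∉ C := fun h => (hmain C hC z h).1 rfl
            have h2 : z + (1, 1) ∉ C := fun h => (hmain C hC _ h).2 rfl
            simp only [weight4, h1, h2]
            split_ifs <;> simp_all
        _ ≤ 2 := by
            rw [Finset.sum_add_distrib]
            exact Nat.add_le_add (hone _) (hone _)
  · push Not at hanti
    calc ∑ C ∈ 𝒞, weight4 C z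
        ≤ ∑ C ∈ 𝒞, ((if z ∈ C then 1 else 0) + (if z + (1, 1) ∈ C then 1 else 0)) := by
          refine Finset.sum_le_sum fun C hC => ?_
          have h1 : z + (1, 0) ∉ C := fun h => (hanti C hC _ h).1 rfl
          have h2 : z + (0, 1) ∉ C := fun h => (hanti C hC _ h).2 rfl
          simp only [weight4, h1, h2]
          split_ifs <;> simp_all
      _ ≤ 2 := by
          rw [Finset.sum_add_distrib]
          exact Nat.add_le_add (hone _) (hone _)

/-- The total weight of a cell is at most the number of its white corners. -/
theorem sum_weight4_le_one {I : Image} {𝒞 : Finset (Finset (ℤ × ℤ))}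
    (h𝒞 : ∀ C ∈ 𝒞, IsWhiteComponent grid4 I C) {z : ℤ × ℤ} (hz : z ∈ sparseCells I) :
    ∑ C ∈ 𝒞, weight4 C z ≤ 1 := by
  classical
  set T : Finset (ℤ × ℤ) := {z, z + (1, 0), z + (0, 1), z + (1, 1)} with hT
  have hTm : ∀ x, x ∈ T ↔ x = z ∨ x = z + (1, 0) ∨ x = z + (0, 1) ∨ x = z + (1, 1) := by
    intro x; simp [hT]
  calc ∑ C ∈ 𝒞, weight4 C z ≤ ∑ C ∈ 𝒞, ∑ x ∈ T, (if x ∈ C then 1 else 0) := by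
        refine Finset.sum_le_sum fun C _ => ?_
        rw [hT, Finset.sum_insert (by simp [Prod.ext_iff]), Finset.sum_insert (by simp),
          Finset.sum_insert (by simp), Finset.sum_singleton]
        simp only [weight4]
        split_ifs <;> simp_all
    _ ≤ ∑ x ∈ T, (if x ∈ whitePixels I then 1 else 0) := by
        rw [Finset.sum_comm]
        exact Finset.sum_le_sum fun x _ => sum_ite_mem_le h𝒞 x
    _ ≤ 1 := by
        rw [Finset.sum_boole]
        refine Finset.card_le_one.2 fun x hx y hy => ?_
        obtain ⟨hx, hxw⟩ := Finset.mem_filter.1 hx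
        obtain ⟨hy, hyw⟩ := Finset.mem_filter.1 hy
        exact hz x y hxw hyw ((hTm x).1 hx) ((hTm y).1 hy)

/-! ### The upper bounds -/

theorem le_F8 {j k : ℕ} (hj : 1 ≤ j) (hk : j ≤ k) :
    (j : ℝ) / ((j : ℝ) + (⌈2 * Real.sqrt (j : ℝ)⌉ : ℝ) + 1) ≤ F8 k (hj.trans hk) :=
  Finset.le_sup' (fun j : ℕ => (j : ℝ) / ((j : ℝ) + (⌈2 * Real.sqrt (j : ℝ)⌉ : ℝ) + 1))
    (Finset.mem_Icc.2 ⟨hj, hk⟩)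

theorem le_F4 {j k : ℕ} (hj : 1 ≤ j) (hk : j ≤ k) :
    (j : ℝ) / ((j : ℝ) + (⌈2 * Real.sqrt (2 * (j : ℝ) - 1)⌉ : ℝ) / 2) ≤ F4 k (hj.trans hk) :=
  Finset.le_sup' (fun j : ℕ => (j : ℝ) / ((j : ℝ) + (⌈2 * Real.sqrt (2 * (j : ℝ) - 1)⌉ : ℝ) / 2))
    (Finset.mem_Icc.2 ⟨hj, hk⟩)

theorem ceil_two_mul_sqrt_nonneg (x : ℝ) : (0 : ℝ) ≤ ⌈2 * Real.sqrt x⌉ := by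
  exact_mod_cast Int.ceil_nonneg (by positivity)

theorem F8_nonneg {k : ℕ} (hk : 1 ≤ k) : 0 ≤ F8 k hk := by
  refine le_trans ?_ (le_F8 le_rfl hk)
  have := ceil_two_mul_sqrt_nonneg ((1 : ℕ) : ℝ)
  positivity

theorem F4_nonneg {k : ℕ} (hk : 1 ≤ k) : 0 ≤ F4 k hk := by
  refine le_trans ?_ (le_F4 le_rfl hk)
  have := ceil_two_mul_sqrt_nonneg (2 * ((1 : ℕ) : ℝ) - 1)
  positivity

theorem density_le_F8 {k : ℕ} (hk : 1 ≤ k) {I : Image} (hI : WhiteComponentsLE grid8 k I) :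
    density I ≤ F8 k hk := by
  classical
  refine density_le_of_count (c := 2 * k + 3) fun m => ?_
  have h := white_count_le grid8_abs_le hI weight8 ∅ ∅ (δ := 0) (μ := F8 k hk) (β := 1) le_rfl
    (F8_nonneg hk) (Set.empty_subset _) ?_ ?_ m
  · rw [ncard_inter_box]
    have e : 2 * ((m : ℝ) + k) + 3 = 2 * m + (2 * k + 3) := by ring
    rw [e] at h
    linarith
  · intro C hC S hS
    have h1 := le_sum_weight8 hC.nonempty hS
    have h2 := le_F8 (Finset.card_pos.2 hC.nonempty) (hC.card_le hI)
    have h3 := ceil_two_mul_sqrt_nonneg (C.card : ℝ)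
    rw [div_le_iff₀ (by positivity)] at h2
    have h4 := mul_le_mul_of_nonneg_left h1 (F8_nonneg hk)
    linarith
  · intro 𝒞 h𝒞 z
    have := sum_weight8_le h𝒞 z
    simp only [Set.mem_empty_iff_false, if_false, add_zero]
    exact_mod_cast this

theorem density_le_F4 {k : ℕ} (hk : 1 ≤ k) {I : Image} (hI : WhiteComponentsLE grid4 k I) :
    density I ≤ F4 k hk := by
  classical
  refine density_le_of_count (c := 2 * k + 3) fun m => ?_
  have h := white_count_le grid4_abs_le hI weight4 ∅ ∅ (δ := 0) (μ := F4 k hk / 2) (β := 2) le_rfl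
    (by have := F4_nonneg hk; positivity) (Set.empty_subset _) ?_ ?_ m
  · rw [ncard_inter_box]
    have e : 2 * ((m : ℝ) + k) + 3 = 2 * m + (2 * k + 3) := by ring
    rw [e] at h
    linarith
  · intro C hC S hS
    have h1 := hC.ceil_le_sum_weight4 hS
    have h2 := le_F4 (Finset.card_pos.2 hC.nonempty) (hC.card_le hI)
    have h3 := ceil_two_mul_sqrt_nonneg (2 * (C.card : ℝ) - 1)
    have h5 : (0 : ℝ) < C.card := by exact_mod_cast Finset.card_pos.2 hC.nonempty
    rw [div_le_iff₀ (by positivity)] at h2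
    have h4 := mul_le_mul_of_nonneg_left h1 (F4_nonneg hk)
    linarith
  · intro 𝒞 h𝒞 z
    have := sum_weight4_le_two h𝒞 z
    simp only [Set.mem_empty_iff_false, if_false, add_zero]
    exact_mod_cast this

theorem whiteComponentsLE_black (G : SimpleGraph (ℤ × ℤ)) (k : ℕ) :
    WhiteComponentsLE G k fun _ => Color.black := by
  intro K
  obtain ⟨⟨x, hx⟩, -⟩ := K.nonempty_supp
  simp [whitePixels] at hx

theorem Phi_le {G : SimpleGraph (ℤ × ℤ)} {k : ℕ} {θ : ℝ}
    (h : ∀ I, WhiteComponentsLE G k I → density I ≤ θ) : Phi G k ≤ θ := by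
  refine csSup_le ⟨_, _, whiteComponentsLE_black G k, rfl⟩ ?_
  rintro r ⟨I, hI, rfl⟩
  exact h I hI

theorem le_Phi {G : SimpleGraph (ℤ × ℤ)} {k : ℕ} {θ : ℝ}
    (h : ∀ I, WhiteComponentsLE G k I → density I ≤ θ) {I : Image}
    (hI : WhiteComponentsLE G k I) : density I ≤ Phi G k := by
  refine le_csSup ⟨θ, ?_⟩ ⟨I, hI, rfl⟩
  rintro r ⟨I, hI, rfl⟩
  exact h I hI

/-! ### Local obstruction to tiling by boxes with sides of different parity -/

/-- In rotated coordinates, the box `[a, b] × [c, d]` is a union of connected components of `w`. -/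
def IsRotTile (w : ℤ → ℤ → Prop) (a b c d : ℤ) : Prop :=
  (∀ u v, (u + v) % 2 = 0 → a ≤ u → u ≤ b → c ≤ v → v ≤ d → w u v) ∧
  ∀ u v u' v', (u + v) % 2 = 0 → a ≤ u → u ≤ b → c ≤ v → v ≤ d →
    (u' = u + 1 ∨ u' = u - 1) → (v' = v + 1 ∨ v' = v - 1) →
    ¬(a ≤ u' ∧ u' ≤ b ∧ c ≤ v' ∧ v' ≤ d) → ¬w u' v'

/-- In rotated coordinates and within distance `R` of `(u₀, v₀)`, every cell has at least two white
pixels and every white pixel lies in a tile with side lengths `e` and `o`. -/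
structure LocallyTiled (w : ℤ → ℤ → Prop) (e o R u₀ v₀ : ℤ) : Prop where
  cell : ∀ u v, (u + v) % 2 = 1 → |u - u₀| ≤ R → |v - v₀| ≤ R →
    (w (u - 1) v ∧ w (u + 1) v) ∨ (w u (v - 1) ∧ w u (v + 1)) ∨ (w (u - 1) v ∧ w u (v - 1)) ∨
    (w (u - 1) v ∧ w u (v + 1)) ∨ (w (u + 1) v ∧ w u (v - 1)) ∨ (w (u + 1) v ∧ w u (v + 1))
  tile : ∀ u v, (u + v) % 2 = 0 → |u - u₀| ≤ R → |v - v₀| ≤ R → w u v →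
    ∃ a b c d, a ≤ u ∧ u ≤ b ∧ c ≤ v ∧ v ≤ d ∧ IsRotTile w a b c d ∧
      ((b - a + 1 = e ∧ d - c + 1 = o) ∨ (b - a + 1 = o ∧ d - c + 1 = e))

section Symmetry

variable {w : ℤ → ℤ → Prop} {e o R u₀ v₀ a b c d : ℤ}

/-- Swaps and reflections reduce the obstruction to one corner of a box in one orientation. -/
theorem IsRotTile.swap (h : IsRotTile w a b c d) : IsRotTile (fun u v => w v u) c d a b := by
  refine ⟨fun u v hp h1 h2 h3 h4 => h.1 v u (by omega) h3 h4 h1 h2, ?_⟩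
  intro u v u' v' hp h1 h2 h3 h4 h5 h6 h7
  exact h.2 v u v' u' (by omega) h3 h4 h1 h2 h6 h5 (by omega)

theorem IsRotTile.neg_left (h : IsRotTile w a b c d) :
    IsRotTile (fun u v => w (-u) v) (-b) (-a) c d := by
  refine ⟨fun u v hp h1 h2 h3 h4 => h.1 (-u) v (by omega) (by omega) (by omega) h3 h4, ?_⟩
  intro u v u' v' hp h1 h2 h3 h4 h5 h6 h7
  exact h.2 (-u) v (-u') v' (by omega) (by omega) (by omega) h3 h4 (by omega) h6 (by omega)

theorem LocallyTiled.swap (h : LocallyTiled w e o R u₀ v₀) :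
    LocallyTiled (fun u v => w v u) e o R v₀ u₀ where
  cell u v hp hu hv := by
    have := h.cell v u (by omega) hv hu
    tauto
  tile u v hp hu hv hw := by
    obtain ⟨a, b, c, d, h1, h2, h3, h4, ht, hd⟩ := h.tile v u (by omega) hv hu hw
    exact ⟨c, d, a, b, h3, h4, h1, h2, ht.swap, by omega⟩

theorem LocallyTiled.neg_left (h : LocallyTiled w e o R u₀ v₀) :
    LocallyTiled (fun u v => w (-u) v) e o R (-u₀) v₀ where
  cell u v hp hu hv := by
    have hu' : |-u - u₀| ≤ R := by
      rw [abs_le] at hu ⊢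
      omega
    have := h.cell (-u) v (by omega) hu' hv
    rw [show -u - 1 = -(u + 1) by ring, show -u + 1 = -(u - 1) by ring] at this
    tauto
  tile u v hp hu hv hw := by
    have hu' : |-u - u₀| ≤ R := by
      rw [abs_le] at hu ⊢
      omega
    obtain ⟨a, b, c, d, h1, h2, h3, h4, ht, hd⟩ := h.tile (-u) v (by omega) hu' hv hw
    exact ⟨-b, -a, c, d, by omega, by omega, h3, h4, ht.neg_left, by omega⟩

end Symmetry

section Obstruction

variable {w : ℤ → ℤ → Prop} {e o R u₀ v₀ a b c d : ℤ}

/-- At a truncated corner of a tile, another tile has its corner in a prescribed position. -/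
theorem LocallyTiled.exists_corner_tile (h : LocallyTiled w e o R u₀ v₀) (he : 2 ≤ e) (ho : 2 ≤ o)
    (ht : IsRotTile w a b c d) (hab : a < b) (hcd : c < d) (hpar : (b + c) % 2 = 1)
    (hu : |b - u₀| + 3 ≤ R) (hv : |c - v₀| + 3 ≤ R) :
    ∃ b' d', IsRotTile w (b + 2) b' (c + 1) d' ∧
      ((b' - (b + 2) + 1 = e ∧ d' - (c + 1) + 1 = o) ∨
        (b' - (b + 2) + 1 = o ∧ d' - (c + 1) + 1 = e)) := by
  have hR : ∀ i x y : ℤ, |x - y| + 3 ≤ R → -3 ≤ i → i ≤ 3 → |x + i - y| ≤ R := by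
    intro i x y hxy h1 h2
    have := abs_le.1 (show |x - y| ≤ R - 3 by linarith)
    rw [abs_le]
    omega
  -- Since `b + c` is odd, the corner `(b, c)` is not a pixel. The black pixels found here are
  -- neighbours of the tile pixels `(b - 1, c)` and `(b, c + 1)`.
  have hB1 : ¬w b (c - 1) :=
    ht.2 (b - 1) c b (c - 1) (by omega) (by omega) (by omega) (by omega) (by omega) (by omega)
      (by omega) (by omega)
  have hB2 : ¬w (b + 1) c :=
    ht.2 b (c + 1) (b + 1) c (by omega) (by omega) (by omega) (by omega) (by omega) (by omega)
      (by omega) (by omega)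
  have hB3 : ¬w (b + 1) (c + 2) :=
    ht.2 b (c + 1) (b + 1) (c + 2) (by omega) (by omega) (by omega) (by omega) (by omega)
      (by omega) (by omega) (by omega)
  -- Two corners of this cell are black, so the other two are white; being adjacent, they lie in one
  -- tile.
  have hcell := h.cell (b + 1) (c - 1) (by omega) (hR 1 _ _ hu (by norm_num) (by norm_num))
    (hR (-1) _ _ hv (by norm_num) (by norm_num))
  rw [show b + 1 - 1 = b by ring, show b + 1 + 1 = b + 2 by ring, show c - 1 - 1 = c - 2 by ring,
    show c - 1 + 1 = c by ring] at hcell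
  have hA : w (b + 2) (c - 1) ∧ w (b + 1) (c - 2) := by tauto
  obtain ⟨a₁, b₁, c₁, d₁, h1, h2, h3, h4, ht₁, -⟩ := h.tile (b + 2) (c - 1) (by omega)
    (hR 2 _ _ hu (by norm_num) (by norm_num)) (hR (-1) _ _ hv (by norm_num) (by norm_num)) hA.1
  have hA1 : a₁ ≤ b + 1 ∧ b + 1 ≤ b₁ ∧ c₁ ≤ c - 2 ∧ c - 2 ≤ d₁ := by
    by_contra hcon
    exact ht₁.2 (b + 2) (c - 1) (b + 1) (c - 2) (by omega) h1 h2 h3 h4 (by omega) (by omega) hcon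
      hA.2
  -- If this tile reached height `c`, it would contain the black pixel `(b + 1, c)`.
  have hd₁ : d₁ = c - 1 := by
    by_contra hne
    exact hB2 (ht₁.1 (b + 1) c (by omega) (by omega) (by omega) (by omega) (by omega))
  have hB4 : ¬w (b + 3) c :=
    ht₁.2 (b + 2) (c - 1) (b + 3) c (by omega) h1 h2 h3 h4 (by omega) (by omega) (by omega)
  have hcell₂ := h.cell (b + 2) c (by omega) (hR 2 _ _ hu (by norm_num) (by norm_num))
    (by have := hR 0 _ _ hv (by norm_num) (by norm_num); rwa [add_zero] at this)
  rw [show b + 2 - 1 = b + 1 by ring, show b + 2 + 1 = b + 3 by ring] at hcell₂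
  have hX : w (b + 2) (c + 1) := by tauto
  obtain ⟨a₂, b₂, c₂, d₂, g1, g2, g3, g4, ht₂, hdim⟩ := h.tile (b + 2) (c + 1) (by omega)
    (hR 2 _ _ hu (by norm_num) (by norm_num)) (hR 1 _ _ hv (by norm_num) (by norm_num)) hX
  -- The black pixels `(b + 1, c)`, `(b + 1, c + 2)`, `(b + 3, c)` and side lengths at least two
  -- force `(b + 2, c + 1)` to be the lower left corner of its tile.
  have n1 : ¬(a₂ ≤ b + 1 ∧ b + 1 ≤ b₂ ∧ c₂ ≤ c ∧ c ≤ d₂) := fun hn =>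
    hB2 (ht₂.1 _ _ (by omega) hn.1 hn.2.1 hn.2.2.1 hn.2.2.2)
  have n2 : ¬(a₂ ≤ b + 1 ∧ b + 1 ≤ b₂ ∧ c₂ ≤ c + 2 ∧ c + 2 ≤ d₂) := fun hn =>
    hB3 (ht₂.1 _ _ (by omega) hn.1 hn.2.1 hn.2.2.1 hn.2.2.2)
  have n3 : ¬(a₂ ≤ b + 3 ∧ b + 3 ≤ b₂ ∧ c₂ ≤ c ∧ c ≤ d₂) := fun hn =>
    hB4 (ht₂.1 _ _ (by omega) hn.1 hn.2.1 hn.2.2.1 hn.2.2.2)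
  obtain rfl : a₂ = b + 2 := by omega
  obtain rfl : c₂ = c + 1 := by omega
  exact ⟨b₂, d₂, ht₂, hdim⟩

/-- As `o` is odd, both ends of the side `u = b` are truncated corners. The tile forced at the lower
one starts at height `c + 1` and has height at least `o - 1`, so it contains `(b + 3, d)`. The tile
forced at the upper one contains `(b + 2, d - 1)` and ends at height `d - 1`, so `(b + 3, d)` is
black. -/
theorem LocallyTiled.false_of_truncated_side (h : LocallyTiled w e o R u₀ v₀) (he : 2 ≤ e)
    (ho : 3 ≤ o) (hodd : o % 2 = 1) (heo : o ≤ e + 1)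
    (ht : IsRotTile w a b c d) (hab : b - a + 1 = e) (hcd : d - c + 1 = o)
    (hpar : (b + c) % 2 = 1) (hu : |b - u₀| + 3 ≤ R) (hvc : |c - v₀| + 3 ≤ R)
    (hvd : |d - v₀| + 3 ≤ R) : False := by
  obtain ⟨b₁, d₁, ht₁, hdim₁⟩ := h.exists_corner_tile he (by omega) ht (by omega) (by omega) hpar
    hu hvc
  have hvd' : |-d - -v₀| + 3 ≤ R := by
    rw [← neg_sub', abs_neg]
    exact hvd
  obtain ⟨b₂, d₂, ht₂, hdim₂⟩ := h.swap.neg_left.swap.exists_corner_tile he (by omega)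
    ht.swap.neg_left.swap (by omega) (by omega) (by omega) hu hvd'
  have hw : w (b + 3) d := ht₁.1 _ _ (by omega) (by omega) (by omega) (by omega) (by omega)
  have hn := ht₂.2 (b + 2) (-d + 1) (b + 3) (-d) (by omega) (by omega) (by omega) (by omega)
    (by omega) (by omega) (by omega) (by omega)
  simp only [neg_neg] at hn
  exact hn hw

/-- As `e` is even, `a` and `b` differ in parity, so one of the sides `u = a`, `u = b` has truncated
corners; a reflection makes it the right one. -/
theorem LocallyTiled.false_of_even_odd (h : LocallyTiled w e o R u₀ v₀) (he : 2 ≤ e)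
    (heven : e % 2 = 0) (ho : 3 ≤ o) (hodd : o % 2 = 1) (heo : o ≤ e + 1) (hRe : e + 3 ≤ R)
    (hRo : o + 3 ≤ R)
    (ht : IsRotTile w a b c d) (hab : b - a + 1 = e) (hcd : d - c + 1 = o)
    (hau : a ≤ u₀) (hub : u₀ ≤ b) (hcv : c ≤ v₀) (hvd : v₀ ≤ d) : False := by
  have habs : ∀ x y r : ℤ, x - y ≤ r - 3 → y - x ≤ r - 3 → |x - y| + 3 ≤ r := by
    intro x y r h1 h2
    have : |x - y| ≤ r - 3 := abs_le.2 (by omega)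
    omega
  by_cases hpar : (b + c) % 2 = 1
  · exact h.false_of_truncated_side he ho hodd heo ht hab hcd hpar (habs _ _ _ (by omega) (by omega))
      (habs _ _ _ (by omega) (by omega)) (habs _ _ _ (by omega) (by omega))
  · exact h.neg_left.false_of_truncated_side he ho hodd heo ht.neg_left (by omega) hcd (by omega)
      (habs _ _ _ (by omega) (by omega)) (habs _ _ _ (by omega) (by omega))
      (habs _ _ _ (by omega) (by omega))

/-- Rotated boxes with sides of different parity and nearly equal length do not tile. -/
theorem LocallyTiled.not_white (h : LocallyTiled w e o R u₀ v₀) (he : 2 ≤ e)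
    (heven : e % 2 = 0) (ho : 3 ≤ o) (hodd : o % 2 = 1) (heo : o ≤ e + 1) (hRe : e + 3 ≤ R)
    (hRo : o + 3 ≤ R) (hpar : (u₀ + v₀) % 2 = 0) : ¬w u₀ v₀ := by
  intro hw
  obtain ⟨a, b, c, d, h1, h2, h3, h4, ht, hd | hd⟩ := h.tile u₀ v₀ hpar
    (by rw [sub_self, abs_zero]; omega) (by rw [sub_self, abs_zero]; omega) hw
  · exact h.false_of_even_odd he heven ho hodd heo hRe hRo ht hd.1 hd.2 h1 h2 h3 h4
  · exact h.swap.false_of_even_odd he heven ho hodd heo hRe hRo ht.swap hd.2 hd.1 h3 h4 h1 h2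

end Obstruction

/-- `C` is a full rotated box with side lengths `e` and `o`. -/
def IsFullBox (e o : ℕ) (C : Finset (ℤ × ℤ)) : Prop :=
  ∃ a b c d : ℤ, C = rotBox a b c d ∧
    ((b - a + 1 = e ∧ d - c + 1 = o) ∨ (b - a + 1 = o ∧ d - c + 1 = e))

/-- The white pixels whose component is not a full rotated box with side lengths `e` and `o`. -/
def irregularPixels (I : Image) (e o : ℕ) : Set (ℤ × ℤ) :=
  {x | x ∈ whitePixels I ∧ ∀ C, IsWhiteComponent grid4 I C → x ∈ C → ¬IsFullBox e o C}

theorem IsWhiteComponent.isRotTile {I : Image} {a b c d : ℤ}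
    (hC : IsWhiteComponent grid4 I (rotBox a b c d)) :
    IsRotTile (fun u v => ((u + v) / 2, (u - v) / 2) ∈ whitePixels I) a b c d := by
  constructor
  · intro u v hp h1 h2 h3 h4
    refine hC.mem_white (mem_rotBox.2 ?_)
    simp only
    omega
  · intro u v u' v' hp h1 h2 h3 h4 h5 h6 h7 hw
    have hm : ((u + v) / 2, (u - v) / 2) ∈ rotBox a b c d := by
      rw [mem_rotBox]
      simp only
      omega
    have hadj : grid4.Adj ((u + v) / 2, (u - v) / 2) ((u' + v') / 2, (u' - v') / 2) := by
      change |(u + v) / 2 - (u' + v') / 2| + |(u - v) / 2 - (u' - v') / 2| = 1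
      rcases abs_cases ((u + v) / 2 - (u' + v') / 2) with g1 | g1 <;>
        rcases abs_cases ((u - v) / 2 - (u' - v') / 2) with g2 | g2 <;> omega
    have hm' := hC.mem_of_adj hm hw hadj
    rw [mem_rotBox] at hm'
    simp only at hm'
    omega

theorem exists_irregular_or_sparse (I : Image) {e o : ℕ}
    (he : 2 ≤ e) (heven : e % 2 = 0) (ho : 3 ≤ o) (hodd : o % 2 = 1) (heo : o ≤ e + 1)
    (z : ℤ × ℤ) : ∃ y, y ∈ irregularPixels I e o ∪ sparseCells I ∧
      |y.1 - z.1| ≤ (e + o + 7 : ℕ) ∧ |y.2 - z.2| ≤ (e + o + 7 : ℕ) := by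
  by_contra! hcon
  have hreg : ∀ y : ℤ × ℤ, |y.1 - z.1| ≤ (e + o + 7 : ℕ) → |y.2 - z.2| ≤ (e + o + 7 : ℕ) →
      y ∉ irregularPixels I e o ∧ y ∉ sparseCells I := by
    intro y h1 h2
    constructor
    · exact fun h => absurd h2 (not_le.2 (hcon y (Or.inl h) h1))
    · exact fun h => absurd h2 (not_le.2 (hcon y (Or.inr h) h1))
  have hz : z ∉ sparseCells I := (hreg z (by rw [sub_self, abs_zero]; positivity)
    (by rw [sub_self, abs_zero]; positivity)).2
  simp only [sparseCells, Set.mem_ofPred_eq, not_forall] at hz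
  obtain ⟨x, -, hxw, -, hx, -⟩ := hz
  have hxz : |x.1 - z.1| ≤ 1 ∧ |x.2 - z.2| ≤ 1 := by
    rcases hx with rfl | rfl | rfl | rfl <;> simp
  rw [abs_le, abs_le] at hxz
  -- The radius `e + o + 3` in rotated coordinates, the distance from `x` to `z` and the rounding
  -- together stay within `e + o + 7`.
  have hnear : ∀ u v i j : ℤ, |u - (x.1 + x.2)| ≤ e + o + 3 → |v - (x.1 - x.2)| ≤ e + o + 3 →
      -2 ≤ i → i ≤ 2 → -2 ≤ j → j ≤ 2 →
      |(u + v + i) / 2 - z.1| ≤ (e + o + 7 : ℕ) ∧ |(u - v + j) / 2 - z.2| ≤ (e + o + 7 : ℕ) := by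
    intro u v i j h1 h2 _ _ _ _
    rw [abs_le] at h1 h2
    rw [abs_le, abs_le]
    push_cast
    omega
  have hloc : LocallyTiled (fun u v => ((u + v) / 2, (u - v) / 2) ∈ whitePixels I) e o (e + o + 3)
      (x.1 + x.2) (x.1 - x.2) := by
    constructor
    · intro u v hp hu hv
      obtain ⟨n1, n2⟩ := hnear u v (-1) (-1) hu hv (by omega) (by omega) (by omega) (by omega)
      have hs := (hreg ((u + v + -1) / 2, (u - v + -1) / 2) n1 n2).2
      simp only [sparseCells, Set.mem_ofPred_eq, not_forall] at hs
      obtain ⟨p, q, hpw, hqw, hp', hq', hne⟩ := hs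
      -- A point `(u, v)` with odd sum is the centre of a cell, whose lower left corner has rotated
      -- coordinates `(u - 1, v)`.
      have e1 : ((u + v + -1) / 2, (u - v + -1) / 2) = ((u - 1 + v) / 2, (u - 1 - v) / 2) := by
        ext <;> simp only <;> omega
      have e2 : ((u + v + -1) / 2, (u - v + -1) / 2) + ((1 : ℤ), (0 : ℤ)) =
          ((u + (v + 1)) / 2, (u - (v + 1)) / 2) := by
        ext <;> simp only [Prod.mk_add_mk] <;> omega
      have e3 : ((u + v + -1) / 2, (u - v + -1) / 2) + ((0 : ℤ), (1 : ℤ)) =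
          ((u + (v - 1)) / 2, (u - (v - 1)) / 2) := by
        ext <;> simp only [Prod.mk_add_mk] <;> omega
      have e4 : ((u + v + -1) / 2, (u - v + -1) / 2) + ((1 : ℤ), (1 : ℤ)) =
          ((u + 1 + v) / 2, (u + 1 - v) / 2) := by
        ext <;> simp only [Prod.mk_add_mk] <;> omega
      rw [e2, e3, e4, e1] at hp' hq'
      rcases hp' with rfl | rfl | rfl | rfl <;> rcases hq' with rfl | rfl | rfl | rfl <;>
        first
          | exact absurd rfl hne
          | (simp only [hpw, hqw, true_and, and_true, true_or, or_true])
    · intro u v hp hu hv hw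
      obtain ⟨n1, n2⟩ := hnear u v 0 0 hu hv (by omega) (by omega) (by omega) (by omega)
      rw [add_zero] at n1 n2
      have hr := (hreg ((u + v) / 2, (u - v) / 2) n1 n2).1
      simp only [irregularPixels, Set.mem_ofPred_eq, not_and, not_forall, not_not] at hr
      obtain ⟨C, hC, hm, a, b, c, d, rfl, hd⟩ := hr hw
      have hm' := mem_rotBox.1 hm
      simp only at hm'
      exact ⟨a, b, c, d, by omega, by omega, by omega, by omega, hC.isRotTile, hd⟩
  refine hloc.not_white (by omega) (by omega) (by omega) (by omega) (by omega) (by omega)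
    (by omega) (by omega) ?_
  have : ((x.1 + x.2 + (x.1 - x.2)) / 2, (x.1 + x.2 - (x.1 - x.2)) / 2) = x := by
    ext <;> simp only <;> omega
  rw [this]
  exact hxw

/-! ### Quantitative loss when even by odd boxes are optimal -/

/-- The arithmetic behind the optimality of boxes with side lengths `e` and `o`. -/
theorem mul_add_le_of_card_le {e o s k j p q : ℤ} (he : 2 ≤ e) (ho : 3 ≤ o)
    (heo : o = e + 1 ∨ e = o + 1) (hs : 2 * s = e * o) (hk : k * (e + o) < s * (e + o + 1))
    (hjk : j ≤ k) (hp : 1 ≤ p) (hq : 1 ≤ q) (hj : 2 * j ≤ p * q + 1) :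
    j * (e + o) < s * (p + q) ∨ (j = s ∧ p + q = e + o) := by
  obtain ⟨w, hw⟩ : ∃ w, w = e + o := ⟨_, rfl⟩
  obtain ⟨t, ht⟩ : ∃ t, t = p + q := ⟨_, rfl⟩
  -- The sides are consecutive, so `w² - 4 e o = 1`.
  have h8s : 8 * s = w ^ 2 - 1 := by
    rcases heo with h | h <;> subst h <;> subst hw <;> linarith
  have hw5 : 5 ≤ w := by omega
  have h8j : 8 * j ≤ t ^ 2 + 4 := by subst ht; nlinarith [sq_nonneg (p - q)]
  rw [← hw, ← ht]
  rw [← hw] at hk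
  have hs0 : 0 ≤ s := by nlinarith
  rcases lt_trichotomy t w with hlt | heq | hgt
  · left
    -- The estimate by `8 j ≤ t² + 4` alone fails at `w = 5`, `t = 4`, where the integrality of `j`
    -- is needed.
    by_cases hw7 : 7 ≤ w
    · have h1 : (t ^ 2 + 4) * w < (w ^ 2 - 1) * t := by
        have ht2 : 0 ≤ t - 2 := by omega
        have hwt : 0 ≤ w - 1 - t := by omega
        have hw0 : 0 ≤ w := by omega
        nlinarith [mul_nonneg (mul_nonneg ht2 hwt) hw0, mul_nonneg hwt (by omega : 0 ≤ w + 1),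
          mul_nonneg hw0 (by omega : 0 ≤ w - 7)]
      nlinarith
    · have hw5' : w = 5 := by omega
      have hs3 : s = 3 := by rw [hw5'] at h8s; omega
      have ht2 : 2 ≤ t := by omega
      rw [hs3, hw5']
      rw [hw5'] at hlt
      have ht5 : t = 2 ∨ t = 3 ∨ t = 4 := by omega
      rcases ht5 with h | h | h <;> rw [h] at h8j ⊢ <;> omega
  -- Now `p + q` is odd, so `p ≠ q`; the bound improves to `8 j ≤ t² + 3`, which gives `j ≤ s`.
  · have hpq : p - q ≠ 0 := by omega
    have h1 := sq_pos_of_ne_zero hpq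
    have h8j' : 8 * j ≤ t ^ 2 + 3 := by
      rw [ht]
      nlinarith
    rw [heq] at h8j'
    rcases lt_or_eq_of_le (show j ≤ s by omega) with hlt | hjs
    · left
      rw [heq]
      nlinarith
    · exact Or.inr ⟨hjs, heq⟩
  -- Here the bound on `k` suffices: `j w ≤ k w < s (w + 1) ≤ s t`.
  · left
    nlinarith

/-- The hypotheses give `(p - e) (p - o) = e o - p q ≤ 1`, whereas for consecutive `e`, `o` this
product is at least `2` at every other integer `p`. -/
theorem eq_or_eq_of_add_eq_of_mul_le {e o p q : ℤ} (heo : o = e + 1 ∨ e = o + 1)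
    (hadd : p + q = e + o) (hmul : e * o ≤ p * q + 1) : (p = e ∧ q = o) ∨ (p = o ∧ q = e) := by
  have hq : q = e + o - p := by omega
  subst hq
  have h1 : (p - e) * (p - o) ≤ 1 := by nlinarith
  by_contra hcon
  have h2 : p ≠ e ∧ p ≠ o := by omega
  rcases heo with rfl | rfl
  · rcases lt_or_gt_of_ne h2.1 with h | h
    · nlinarith
    · have : e + 1 < p := by omega
      nlinarith
  · rcases lt_or_gt_of_ne h2.2 with h | h
    · nlinarith
    · have : o + 1 < p := by omega
      nlinarith

/-- The comparison is kept in integers so that a strict inequality leaves a gap of at least one. In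
the remaining case `|C| = s = e o / 2` and the box around `C` has sides `e` and `o`, hence exactly
`s` pixels. -/
theorem IsWhiteComponent.lt_sum_weight4_or_isFullBox {I : Image} {C S : Finset (ℤ × ℤ)}
    {e o s k : ℕ} (hC : IsWhiteComponent grid4 I C)
    (hS : ∀ p ∈ C, Finset.Icc (p.1 - 1) p.1 ×ˢ Finset.Icc (p.2 - 1) p.2 ⊆ S)
    (he : 2 ≤ e) (heven : Even e) (ho : 3 ≤ o) (heo : o = e + 1 ∨ e = o + 1) (hs : 2 * s = e * o)
    (hk : k * (e + o) < s * (e + o + 1)) (hCk : C.card ≤ k) :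
    (2 * s + (e + o)) * C.card < s * ∑ z ∈ S, weight4 C z ∨
      ((2 * s + (e + o)) * C.card ≤ s * ∑ z ∈ S, weight4 C z ∧ IsFullBox e o C) := by
  obtain ⟨a, c, p, q, hp, hq, hsub⟩ := hC.exists_rotBox
  have h1 := le_sum_weight4 hS
  rw [hp, hq] at h1
  have hcard := Finset.card_le_card hsub
  have h2 : 2 * C.card ≤ p * q + 1 :=
    (Nat.mul_le_mul_left 2 hcard).trans (two_mul_card_rotBox_le a c p q)
  have hp1 : 1 ≤ p := hp ▸ Finset.card_pos.2 (hC.nonempty.image _)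
  have hq1 : 1 ≤ q := hq ▸ Finset.card_pos.2 (hC.nonempty.image _)
  have h3 := Nat.mul_le_mul_left s h1
  have key := mul_add_le_of_card_le (e := e) (o := o) (s := s) (k := k) (j := C.card) (p := p)
    (q := q) (by omega) (by omega) (by omega) (by exact_mod_cast hs) (by exact_mod_cast hk)
    (by omega) (by omega) (by omega) (by exact_mod_cast h2)
  rcases key with h | ⟨hjs, hpq⟩
  · left
    have h : C.card * (e + o) < s * (p + q) := by exact_mod_cast h
    nlinarith
  · right
    have hjs : C.card = s := by exact_mod_cast hjs
    have hpq' : p + q = e + o := by exact_mod_cast hpq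
    refine ⟨?_, ?_⟩
    · rw [hjs, ← hpq'] at *
      nlinarith
    · have hcases := eq_or_eq_of_add_eq_of_mul_le (e := e) (o := o) (p := p) (q := q) (by omega)
        hpq (by rw [hjs, hs] at h2; exact_mod_cast h2)
      have hev : Even p ∨ Even q := by
        rcases hcases with h | h
        · left
          rwa [show p = e by exact_mod_cast h.1]
        · right
          rwa [show q = e by exact_mod_cast h.2]
      have hmul : p * q = e * o := by
        rcases hcases with h | h
        · rw [show p = e by exact_mod_cast h.1, show q = o by exact_mod_cast h.2]
        · rw [show p = o by exact_mod_cast h.1, show q = e by exact_mod_cast h.2, mul_comm]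
      have hbox := two_mul_card_rotBox_of_even a c hev
      refine ⟨a, a + p - 1, c, c + q - 1, Finset.eq_of_subset_of_card_le hsub (by omega), ?_⟩
      omega

/-- If all components have size at most `k`, where boxes with side lengths `e` and `o` are the only
optimal ones, then the density is bounded away from the density of these boxes. -/
theorem exists_lt_forall_density_le {e o s k : ℕ} (he : 2 ≤ e) (heven : Even e) (ho : 3 ≤ o)
    (heo : o = e + 1 ∨ e = o + 1) (hs : 2 * s = e * o)
    (hk : k * (e + o) < s * (e + o + 1)) (hk1 : 1 ≤ k) :
    ∃ θ : ℝ, θ < 2 * (s : ℝ) / (2 * s + (e + o)) ∧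
      ∀ I, WhiteComponentsLE grid4 k I → density I ≤ θ := by
  classical
  have hs1 : 1 ≤ s := by nlinarith
  have hL : (0 : ℝ) < 2 * s + (e + o) := by positivity
  have hk0 : (0 : ℝ) < k := by exact_mod_cast hk1
  -- The integer gap of one, shared by at most `k` pixels and divided by `2 s + e + o`.
  set δ : ℝ := 1 / (k * (2 * s + (e + o))) with hδ
  have hδ0 : 0 < δ := by positivity
  refine ⟨2 * (s : ℝ) / (2 * s + (e + o)) - δ / (2 * ((e + o + 7 : ℕ) : ℝ) + 1) ^ 2, ?_, ?_⟩
  · have : 0 < δ / (2 * ((e + o + 7 : ℕ) : ℝ) + 1) ^ 2 := by positivity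
    linarith
  intro I hI
  refine density_le_of_count_of_dense (D := irregularPixels I e o) (E := sparseCells I)
    (c := 2 * k + 3) hδ0.le (fun m => ?_) (exists_irregular_or_sparse I he
      (Nat.even_iff.1 heven) ho (by have := Nat.even_iff.1 heven; omega) (by omega))
  have h := white_count_le grid4_abs_le hI weight4 (irregularPixels I e o) (sparseCells I) (δ := δ)
    (μ := s / (2 * s + (e + o))) (β := 2) hδ0.le ?_ (fun x hx => hx.1) ?_ ?_ m
  · have e1 : 2 * ((m : ℝ) + k) + 3 = 2 * m + (2 * k + 3) := by ring
    have e2 : (s : ℝ) / (2 * s + (e + o)) * 2 = 2 * s / (2 * s + (e + o)) := by ring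
    rwa [e1, e2] at h
  · rw [hδ, one_div, mul_inv, div_eq_mul_inv]
    refine mul_le_mul_of_nonneg_right ?_ (by positivity)
    exact (inv_le_one_of_one_le₀ (by exact_mod_cast hk1)).trans (by exact_mod_cast hs1)
  · intro C hC S hS
    have hCk := hC.card_le hI
    rw [div_mul_eq_mul_div (s : ℝ), le_div_iff₀ hL]
    have hδL : δ * (2 * s + (e + o)) * k = 1 := by
      rw [hδ]
      field_simp
    rcases hC.lt_sum_weight4_or_isFullBox hS he heven ho heo hs hk hCk with h | ⟨h, hfull⟩
    · have h' : (2 * (s : ℝ) + (e + o)) * C.card + 1 ≤ s * ∑ z ∈ S, (weight4 C z : ℝ) := by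
        exact_mod_cast h
      have hf : ((C.filter (· ∈ irregularPixels I e o)).card : ℝ) ≤ k := by
        exact_mod_cast (Finset.card_filter_le _ _).trans hCk
      have := mul_le_mul_of_nonneg_left hf (show 0 ≤ δ * (2 * s + (e + o)) by positivity)
      nlinarith
    · have h' : (2 * (s : ℝ) + (e + o)) * C.card ≤ s * ∑ z ∈ S, (weight4 C z : ℝ) := by
        exact_mod_cast h
      have hf : C.filter (· ∈ irregularPixels I e o) = ∅ :=
        Finset.filter_eq_empty_iff.2 fun x hx hxi => hxi.2 C hC hx hfull
      rw [hf, Finset.card_empty, Nat.cast_zero, mul_zero, add_zero]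
      linarith
  · intro 𝒞 h𝒞 z
    split_ifs with hz
    · have := sum_weight4_le_one h𝒞 hz
      have : (∑ C ∈ 𝒞, (weight4 C z : ℝ)) ≤ 1 := by exact_mod_cast this
      linarith
    · have := sum_weight4_le_two h𝒞 z
      rw [add_zero]
      exact_mod_cast this

/-! ### Density and components of periodic images -/

theorem le_density_of_tendsto {I : Image} {v : ℕ → ℝ} {θ : ℝ}
    (hv : ∀ᶠ m : ℕ in Filter.atTop,
      v m ≤ ((whitePixels I ∩ box m).ncard : ℝ) / (2 * (m : ℝ) + 1) ^ 2)
    (hθ : Filter.Tendsto v Filter.atTop (nhds θ)) : θ ≤ density I := by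
  classical
  rw [← hθ.liminf_eq]
  refine Filter.liminf_le_liminf hv hθ.isBoundedUnder_ge ?_
  refine Filter.IsBoundedUnder.isCoboundedUnder_ge (Filter.isBoundedUnder_of ⟨1, fun m => ?_⟩)
  rw [ncard_inter_box, div_le_one (by positivity)]
  have := (Finset.card_filter_le (boxF m) (· ∈ whitePixels I)).trans (card_boxF m).le
  exact_mod_cast this

/-- If, for every pixel, at least `r` of its `N` translates by fixed vectors are white, the density
is at least `r / N`. -/
theorem div_le_density_of_translates {I : Image} {N r K : ℕ} (hN : 0 < N) (g : ℕ → ℤ × ℤ)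
    (hg : ∀ i < N, |(g i).1| ≤ K ∧ |(g i).2| ≤ K)
    (h : ∀ z, ∃ s ⊆ Finset.range N, r ≤ s.card ∧ ∀ i ∈ s, z + g i ∈ whitePixels I) :
    (r : ℝ) / N ≤ density I := by
  classical
  have ht := (tendsto_box_ratio (1 - 2 * K)).const_mul ((r : ℝ) / N)
  rw [mul_one] at ht
  refine le_density_of_tendsto ?_ ht
  filter_upwards [Filter.eventually_ge_atTop K] with m hm
  obtain ⟨l, rfl⟩ := Nat.exists_eq_add_of_le hm
  rw [← mul_div_assoc, ncard_inter_box]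
  refine div_le_div_of_nonneg_right ?_ (by positivity)
  have h1 : ∑ _z ∈ boxF l, r ≤
      ∑ z ∈ boxF l, ∑ i ∈ Finset.range N, if z + g i ∈ whitePixels I then 1 else 0 := by
    refine Finset.sum_le_sum fun z _ => ?_
    obtain ⟨s, hs, hr, hw⟩ := h z
    rw [Finset.sum_boole]
    exact hr.trans (Finset.card_le_card fun i hi => Finset.mem_filter.2 ⟨hs hi, hw i hi⟩)
  have h2 : ∀ i ∈ Finset.range N, ∑ z ∈ boxF l, (if z + g i ∈ whitePixels I then 1 else 0) ≤
      ((boxF (K + l)).filter (· ∈ whitePixels I)).card := by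
    intro i hi
    rw [Finset.sum_boole, ← Finset.card_image_of_injective _ (add_left_injective (g i))]
    refine Finset.card_le_card fun z hz => ?_
    obtain ⟨y, hy, rfl⟩ := Finset.mem_image.1 hz
    obtain ⟨hyb, hyw⟩ := Finset.mem_filter.1 hy
    refine Finset.mem_filter.2 ⟨?_, hyw⟩
    obtain ⟨g1, g2⟩ := hg i (Finset.mem_range.1 hi)
    rw [abs_le] at g1 g2
    rw [mem_boxF] at hyb ⊢
    simp only [Prod.fst_add, Prod.snd_add]
    push_cast
    omega
  rw [Finset.sum_comm, Finset.sum_const, card_boxF, smul_eq_mul] at h1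
  have h3 := h1.trans (Finset.sum_le_sum h2)
  rw [Finset.sum_const, Finset.card_range, smul_eq_mul] at h3
  have h4 : (2 * (l : ℝ) + 1) ^ 2 * r ≤
      N * (((boxF (K + l)).filter (· ∈ whitePixels I)).card : ℝ) := by exact_mod_cast h3
  have hN' : (0 : ℝ) < N := by exact_mod_cast hN
  have e : 2 * ((K + l : ℕ) : ℝ) + (1 - 2 * K) = 2 * l + 1 := by push_cast; ring
  rw [e, div_mul_eq_mul_div, div_le_iff₀ hN']
  linarith

/-- Components are bounded if every white pixel lies in a small set closed under white
adjacency. -/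
theorem whiteComponentsLE_of_closed {G : SimpleGraph (ℤ × ℤ)} {I : Image} {k : ℕ}
    (h : ∀ x ∈ whitePixels I, ∃ A : Finset (ℤ × ℤ), x ∈ A ∧ A.card ≤ k ∧
      ∀ y ∈ A, ∀ z ∈ whitePixels I, G.Adj y z → z ∈ A) : WhiteComponentsLE G k I := by
  intro K
  obtain ⟨x, hx⟩ := K.nonempty_supp
  obtain ⟨A, hxA, hA, hcl⟩ := h x x.2
  have key : ∀ a b : whitePixels I, (G.induce (whitePixels I)).Walk a b → (a : ℤ × ℤ) ∈ A →
      (b : ℤ × ℤ) ∈ A := by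
    intro a b w
    induction w with
    | nil => exact id
    | @cons a b d hab w ih =>
      exact fun ha => ih (hcl a ha b b.2 (by simpa [SimpleGraph.comap_adj] using hab))
  rw [← Subtype.val_injective.encard_image]
  refine le_trans (Set.encard_le_encard (t := (A : Set (ℤ × ℤ))) ?_) ?_
  · rintro _ ⟨y, hy, rfl⟩
    obtain ⟨w⟩ := SimpleGraph.ConnectedComponent.exact (hx.trans hy.symm)
    exact key _ _ w hxA
  · rw [Set.encard_coe_eq_coe_finsetCard]
    exact_mod_cast hA

open Classical in
/-- The periodic image whose white pixels are the translates of `T` by the lattice of all `z` for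
which `a * z.1 + b * z.2` is divisible by `M`. -/
def latticeImage (M : ℕ) (a b : ℤ) (T : Finset (ℤ × ℤ)) : Image := fun z =>
  if ∃ c ∈ T, (M : ℤ) ∣ (a * z.1 + b * z.2) - (a * c.1 + b * c.2) then Color.white else Color.black

theorem mem_whitePixels_latticeImage {M : ℕ} {a b : ℤ} {T : Finset (ℤ × ℤ)} {z : ℤ × ℤ} :
    z ∈ whitePixels (latticeImage M a b T) ↔
      ∃ c ∈ T, (M : ℤ) ∣ (a * z.1 + b * z.2) - (a * c.1 + b * c.2) := by
  simp only [whitePixels, latticeImage, Set.mem_ofPred_eq]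
  split_ifs with h <;> simp [h]

/-- By the Bézout relation the vectors `i (X, Y)` with `i < M` run through all residues of `a x + b
y` modulo `M`, of which `T` occupies `|T|`. -/
theorem le_density_latticeImage {M : ℕ} (hM : 0 < M) {a b X Y : ℤ} (hab : a * X + b * Y = 1)
    {T : Finset (ℤ × ℤ)}
    (hT : ∀ c ∈ T, ∀ c' ∈ T, (M : ℤ) ∣ (a * c.1 + b * c.2) - (a * c'.1 + b * c'.2) → c = c') :
    (T.card : ℝ) / M ≤ density (latticeImage M a b T) := by
  have hM' : (0 : ℤ) < M := by exact_mod_cast hM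
  refine div_le_density_of_translates (K := M * (X.natAbs + Y.natAbs)) hM
    (fun i => (i * X, i * Y)) ?_ ?_
  · intro i hi
    simp only [abs_mul, Nat.abs_cast, Nat.cast_mul, Nat.cast_add, Int.natCast_natAbs]
    have : (i : ℤ) ≤ M := by exact_mod_cast hi.le
    constructor
    · exact mul_le_mul this (by linarith [abs_nonneg Y]) (abs_nonneg _) hM'.le
    · exact mul_le_mul this (by linarith [abs_nonneg X]) (abs_nonneg _) hM'.le
  · intro z
    set f : ℤ × ℤ → ℕ := fun c =>
      (((a * c.1 + b * c.2) - (a * z.1 + b * z.2)) % M).toNat with hf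
    have hfz : ∀ c, ((f c : ℕ) : ℤ) = ((a * c.1 + b * c.2) - (a * z.1 + b * z.2)) % M :=
      fun c => Int.toNat_of_nonneg (Int.emod_nonneg _ hM'.ne')
    refine ⟨T.image f, ?_, ?_, ?_⟩
    · intro i hi
      obtain ⟨c, -, rfl⟩ := Finset.mem_image.1 hi
      rw [Finset.mem_range]
      have := Int.emod_lt_of_pos ((a * c.1 + b * c.2) - (a * z.1 + b * z.2)) hM'
      rw [← hfz] at this
      exact_mod_cast this
    · refine (Finset.card_image_of_injOn ?_).ge
      intro c hc c' hc' hcc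
      refine hT c hc c' hc' ?_
      have h1 : ((a * c.1 + b * c.2) - (a * z.1 + b * z.2)) % M =
          ((a * c'.1 + b * c'.2) - (a * z.1 + b * z.2)) % M := by rw [← hfz, ← hfz, hcc]
      have h2 := Int.dvd_of_emod_eq_zero (Int.emod_eq_emod_iff_emod_sub_eq_zero.1 h1)
      rwa [sub_sub_sub_cancel_right] at h2
    · intro i hi
      obtain ⟨c, hc, rfl⟩ := Finset.mem_image.1 hi
      refine mem_whitePixels_latticeImage.2 ⟨c, hc, ?_⟩
      simp only [Prod.fst_add, Prod.snd_add, hfz]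
      have h1 := Int.emod_add_mul_ediv ((a * c.1 + b * c.2) - (a * z.1 + b * z.2)) M
      set r := ((a * c.1 + b * c.2) - (a * z.1 + b * z.2)) % M
      set q := ((a * c.1 + b * c.2) - (a * z.1 + b * z.2)) / M
      refine ⟨-q, ?_⟩
      have : a * (z.1 + r * X) + b * (z.2 + r * Y) - (a * c.1 + b * c.2) =
          (a * z.1 + b * z.2) + r * (a * X + b * Y) - (a * c.1 + b * c.2) := by ring
      rw [this, hab]
      linarith

/-- One period suffices: the closed set found for `c ∈ T` is translated by the lattice vector `x -
c`. -/
theorem whiteComponentsLE_latticeImage {G : SimpleGraph (ℤ × ℤ)}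
    (hG : ∀ x y t, G.Adj x y → G.Adj (x - t) (y - t)) {M k : ℕ} {a b : ℤ} {T : Finset (ℤ × ℤ)}
    (h : ∀ c ∈ T, ∃ A : Finset (ℤ × ℤ), c ∈ A ∧ A.card ≤ k ∧ ∀ c' ∈ A, ∀ z, G.Adj c' z →
      ∀ c'' ∈ T, (M : ℤ) ∣ (a * z.1 + b * z.2) - (a * c''.1 + b * c''.2) → z ∈ A) :
    WhiteComponentsLE G k (latticeImage M a b T) := by
  refine whiteComponentsLE_of_closed fun x hx => ?_
  obtain ⟨c, hc, hdvd⟩ := mem_whitePixels_latticeImage.1 hx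
  obtain ⟨A, hcA, hcard, hcl⟩ := h c hc
  refine ⟨A.image (· + (x - c)), Finset.mem_image.2 ⟨c, hcA, by simp⟩,
    Finset.card_image_le.trans hcard, ?_⟩
  intro y hy z hz hyz
  obtain ⟨c', hc', rfl⟩ := Finset.mem_image.1 hy
  obtain ⟨c'', hc'', hdvd'⟩ := mem_whitePixels_latticeImage.1 hz
  have hadj := hG _ _ (x - c) hyz
  simp only [add_sub_cancel_right] at hadj
  refine Finset.mem_image.2 ⟨z - (x - c), hcl c' hc' _ hadj c'' hc'' ?_, by simp⟩
  have := dvd_sub hdvd' hdvd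
  simp only [Prod.fst_sub, Prod.snd_sub]
  refine this.trans (dvd_of_eq ?_)
  ring

theorem grid4_adj_sub (x y t : ℤ × ℤ) (h : grid4.Adj x y) : grid4.Adj (x - t) (y - t) := by
  simpa [grid4, d4] using h

theorem grid8_adj_sub (x y t : ℤ × ℤ) (h : grid8.Adj x y) : grid8.Adj (x - t) (y - t) := by
  simpa [grid8, d8] using h

/-! ### Optimal images for 8-adjacency -/

section Grid8

/-- A rectangle with sides `a` and `b`, together with `c` pixels of the next row. -/
def partialRect (a b c : ℕ) : Finset (ℤ × ℤ) :=
  Finset.Ico (0 : ℤ) a ×ˢ Finset.Ico (0 : ℤ) b ∪ Finset.Ico (0 : ℤ) c ×ˢ {(b : ℤ)}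

theorem mem_partialRect {a b c : ℕ} {z : ℤ × ℤ} : z ∈ partialRect a b c ↔
    ((0 ≤ z.1 ∧ z.1 < a) ∧ (0 ≤ z.2 ∧ z.2 < b)) ∨ ((0 ≤ z.1 ∧ z.1 < c) ∧ z.2 = b) := by
  simp only [partialRect, Finset.mem_union, Finset.mem_product, Finset.mem_Ico,
    Finset.mem_singleton]

theorem card_partialRect (a b c : ℕ) : (partialRect a b c).card = a * b + c := by
  rw [partialRect, Finset.card_union_of_disjoint]
  · simp
  · rw [Finset.disjoint_left]
    intro z h1 h2
    simp only [Finset.mem_product, Finset.mem_Ico, Finset.mem_singleton] at h1 h2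
    omega

/-- The case `z = p` separates the residues of the tile; neighbours `z` of `p` separate the
translates. The difference `(X, Y)` has `|X| ≤ a`, and `Y = b + 1` or `Y = -(b + 1)` involves the
partial row, whence `X ≤ c` or `X ≥ -c` respectively. So `X + (a + 1) Y` is smaller in absolute
value than the modulus, hence zero, and then `Y = 0`. -/
theorem eq_of_mem_partialRect {a b c : ℕ} (hca : c ≤ a) {p q z : ℤ × ℤ}
    (hp : p ∈ partialRect a b c) (hq : q ∈ partialRect a b c) (h1 : |p.1 - z.1| ≤ 1)
    (h2 : |p.2 - z.2| ≤ 1)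
    (hdvd : (((a + 1) * (b + 1) + c + 1 : ℕ) : ℤ) ∣
      (1 * z.1 + (a + 1 : ℤ) * z.2) - (1 * q.1 + (a + 1 : ℤ) * q.2)) : z = q := by
  rw [mem_partialRect] at hp hq
  rw [abs_le] at h1 h2
  obtain ⟨l, hl⟩ := hdvd
  push_cast at hl
  have hX : -(a : ℤ) ≤ z.1 - q.1 ∧ z.1 - q.1 ≤ a := by omega
  obtain ⟨X, hXd⟩ : ∃ X, X = z.1 - q.1 := ⟨_, rfl⟩
  obtain ⟨Y, hYd⟩ : ∃ Y, Y = z.2 - q.2 := ⟨_, rfl⟩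
  have hl' : X + (a + 1) * Y = ((a + 1) * (b + 1) + c + 1) * l := by
    rw [← hl, hXd, hYd]; ring
  have hup : X + (a + 1) * Y < (a + 1) * (b + 1) + c + 1 := by
    rcases (show Y ≤ b ∨ (Y = b + 1 ∧ X ≤ c) by omega) with h | ⟨h, h'⟩
    · nlinarith
    · rw [h]; linarith
  have hlo : -((a + 1) * (b + 1) + c + 1 : ℤ) < X + (a + 1) * Y := by
    rcases (show -(b : ℤ) ≤ Y ∨ (Y = -(b + 1) ∧ -(c : ℤ) ≤ X) by omega) with h | ⟨h, h'⟩
    · nlinarith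
    · rw [h]; linarith
  have hl0 : l = 0 := by
    rw [hl'] at hup hlo
    have hpos : (0 : ℤ) < (a + 1) * (b + 1) + c + 1 := by positivity
    have u1 : l < 1 := by nlinarith
    have u2 : -1 < l := by nlinarith
    omega
  rw [hl0, mul_zero] at hl'
  have hY0 : Y = 0 := by
    have u1 : Y < 1 := by nlinarith
    have u2 : -1 < Y := by nlinarith
    omega
  rw [hY0, mul_zero, add_zero] at hl'
  ext <;> omega

theorem le_Phi8_of_partialRect {a b c k : ℕ} (hca : c ≤ a) (hk : 1 ≤ k) (hk' : a * b + c ≤ k) :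
    ((a * b + c : ℕ) : ℝ) / ((a + 1) * (b + 1) + c + 1 : ℕ) ≤ Phi8 k := by
  rw [← card_partialRect a b c]
  refine (le_density_latticeImage (a := 1) (b := a + 1) (X := 1) (Y := 0) (by positivity)
    (by ring) ?_).trans (le_Phi (fun I => density_le_F8 hk) ?_)
  · intro p hp q hq hdvd
    exact eq_of_mem_partialRect hca hp hq (by simp) (by simp) hdvd
  · refine whiteComponentsLE_latticeImage grid8_adj_sub fun p hp => ⟨_, hp, ?_, ?_⟩
    · rwa [card_partialRect]
    · intro p' hp' z hz q hq hdvd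
      obtain ⟨h1, h2⟩ := grid8_abs_le _ _ hz
      rwa [eq_of_mem_partialRect hca hp' hq h1 h2 hdvd]

/-- With `n² < j ≤ (n + 1)²`, one takes an `n × n` square or an `(n + 1) × n` rectangle plus a
nonempty partial row. Then `a + b` is the largest integer needed with `(a + b)² < 4 j`. -/
theorem exists_partialRect {j : ℕ} (hj : 1 ≤ j) : ∃ a b c : ℕ, c ≤ a ∧ j = a * b + c ∧
    ((a + b + 1 : ℕ) : ℤ) ≤ ⌈2 * Real.sqrt j⌉ := by
  have hceil : ∀ n : ℕ, n ^ 2 < 4 * j → ((n + 1 : ℕ) : ℤ) ≤ ⌈2 * Real.sqrt j⌉ := by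
    intro n hn
    have : (n : ℤ) < ⌈2 * Real.sqrt j⌉ := by
      rw [Int.lt_ceil]
      have h1 : (n : ℝ) / 2 < Real.sqrt j := by
        rw [Real.lt_sqrt (by positivity), div_pow, div_lt_iff₀ (by norm_num)]
        norm_num
        exact_mod_cast (by linarith : n ^ 2 < j * 4)
      push_cast
      linarith
    push_cast
    omega
  obtain ⟨n, hn⟩ : ∃ n, n = Nat.sqrt (j - 1) := ⟨_, rfl⟩
  have h1 : n * n ≤ j - 1 := hn ▸ Nat.sqrt_le (j - 1)
  have h2 : j - 1 < (n + 1) * (n + 1) := hn ▸ Nat.lt_succ_sqrt (j - 1)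
  by_cases h : j ≤ n * n + n
  · refine ⟨n, n, j - n * n, by omega, by omega, ?_⟩
    have := hceil (n + n) (by nlinarith [show n * n + 1 ≤ j by omega])
    exact this
  · have e : (n + 1) * n = n * n + n := by ring
    refine ⟨n + 1, n, j - (n * n + n), ?_, by rw [e]; omega, ?_⟩
    · have e2 : (n + 1) * (n + 1) = n * n + 2 * n + 1 := by ring
      omega
    · exact hceil (n + 1 + n) (by nlinarith [show n * n + n + 1 ≤ j by omega])

theorem Phi8_eq {k : ℕ} (hk : 1 ≤ k) : Phi8 k = F8 k hk := by
  refine le_antisymm (Phi_le fun I => density_le_F8 hk) ?_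
  refine Finset.sup'_le _ _ fun j hj => ?_
  obtain ⟨hj1, hjk⟩ := Finset.mem_Icc.1 hj
  obtain ⟨a, b, c, hca, hjabc, hceil⟩ := exists_partialRect hj1
  refine le_trans ?_ (le_Phi8_of_partialRect (b := b) hca hk (hjabc ▸ hjk))
  rw [← hjabc]
  refine div_le_div_of_nonneg_left (by positivity) (by positivity) ?_
  have hceil' : ((a + b + 1 : ℕ) : ℝ) ≤ (⌈2 * Real.sqrt (j : ℝ)⌉ : ℝ) := by exact_mod_cast hceil
  have e : (((a + 1) * (b + 1) + c + 1 : ℕ) : ℝ) =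
      ((a * b + c : ℕ) : ℝ) + ((a + b + 1 : ℕ) : ℝ) + 1 := by
    push_cast; ring
  rw [e, ← hjabc]
  linarith

end Grid8

/-! ### Optimal images for 4-adjacency -/

section NotchedBox

variable {α β i : ℕ}

/-- A rotated box with side lengths `2 * α - 1` and `2 * β - 1` from one of whose extreme diagonals
`i` pixels have been removed. -/
def notchedBox (α β i : ℕ) : Finset (ℤ × ℤ) :=
  rotBox 0 (2 * α - 2) 0 (2 * β - 2) \ (Finset.range i).image fun t : ℕ => ((t : ℤ), -(t : ℤ))

theorem mem_notchedBox {z : ℤ × ℤ} : z ∈ notchedBox α β i ↔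
    ((0 ≤ z.1 + z.2 ∧ z.1 + z.2 ≤ 2 * α - 2) ∧ (0 ≤ z.1 - z.2 ∧ z.1 - z.2 ≤ 2 * β - 2)) ∧
      (z.1 + z.2 = 0 → 2 * (i : ℤ) ≤ z.1 - z.2) := by
  rw [notchedBox, Finset.mem_sdiff, mem_rotBox, Finset.mem_image]
  refine and_congr_right fun h => ?_
  constructor
  · intro hn h0
    by_contra hlt
    refine hn ⟨z.1.toNat, Finset.mem_range.2 (by omega), ?_⟩
    ext <;> simp only <;> omega
  · rintro hn ⟨t, ht, rfl⟩
    rw [Finset.mem_range] at ht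
    simp only at hn
    omega

theorem card_notchedBox (hα : 1 ≤ α) (hi : i < β) :
    ((notchedBox α β i).card : ℤ) = α * β + (α - 1) * (β - 1) - i := by
  have hsub : ((Finset.range i).image fun t : ℕ => ((t : ℤ), -(t : ℤ))) ⊆
      rotBox 0 (2 * α - 2) 0 (2 * β - 2) := by
    intro z hz
    obtain ⟨t, ht, rfl⟩ := Finset.mem_image.1 hz
    rw [Finset.mem_range] at ht
    rw [mem_rotBox]
    simp only
    omega
  have hinj : ((Finset.range i).image fun t : ℕ => ((t : ℤ), -(t : ℤ))).card = i := by
    rw [Finset.card_image_of_injective, Finset.card_range]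
    intro s t hst
    simpa using hst
  have h1 := two_mul_card_rotBox 0 0 (2 * α - 1) (2 * β - 1)
  have e1 : (0 : ℤ) + (2 * α - 1 : ℕ) - 1 = 2 * α - 2 := by omega
  have e2 : (0 : ℤ) + (2 * β - 1 : ℕ) - 1 = 2 * β - 2 := by omega
  have o1 : ¬Even (2 * α - 1) := by rw [Nat.not_even_iff]; omega
  have o2 : ¬Even (2 * β - 1) := by rw [Nat.not_even_iff]; omega
  have c1 : ((2 * α - 1 : ℕ) : ℤ) = 2 * α - 1 := by omega
  have c2 : ((2 * β - 1 : ℕ) : ℤ) = 2 * β - 1 := by omega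
  rw [e1, e2, if_neg o1, if_neg o2, c1, c2] at h1
  simp only [paritySign, Even.zero, if_true] at h1
  have h2 := Finset.card_sdiff_add_card_eq_card hsub
  rw [hinj] at h2
  have h3 : ((notchedBox α β i).card : ℤ) + i =
      (rotBox 0 (2 * α - 2) 0 (2 * β - 2)).card := by exact_mod_cast h2
  linarith

/-- The point reflection that maps a notched box to its partner in the tiling. -/
def flip (i : ℕ) (z : ℤ × ℤ) : ℤ × ℤ := ((i : ℤ) - 1 - z.1, 1 - (i : ℤ) - z.2)

theorem flip_flip (i : ℕ) (z : ℤ × ℤ) : flip i (flip i z) = z := by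
  ext <;> simp only [flip] <;> ring

theorem flip_injective (i : ℕ) : Function.Injective (flip i) :=
  Function.LeftInverse.injective (flip_flip i)

theorem mem_image_flip {A : Finset (ℤ × ℤ)} {z : ℤ × ℤ} : z ∈ A.image (flip i) ↔ flip i z ∈ A := by
  constructor
  · intro h
    obtain ⟨y, hy, rfl⟩ := Finset.mem_image.1 h
    rwa [flip_flip]
  · exact fun h => Finset.mem_image.2 ⟨_, h, flip_flip i z⟩

/-- Two pixels at distance at most one in both diagonal coordinates. -/
def DiagClose (x y : ℤ × ℤ) : Prop :=
  (-1 ≤ (x.1 + x.2) - (y.1 + y.2) ∧ (x.1 + x.2) - (y.1 + y.2) ≤ 1) ∧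
    (-1 ≤ (x.1 - x.2) - (y.1 - y.2) ∧ (x.1 - x.2) - (y.1 - y.2) ≤ 1)

theorem diagClose_of_adj {x y : ℤ × ℤ} (h : grid4.Adj x y) : DiagClose x y := by
  have := grid4_adj h
  rcases abs_cases (x.1 - y.1) with h1 | h1 <;> rcases abs_cases (x.2 - y.2) with h2 | h2 <;>
    refine ⟨⟨?_, ?_⟩, ?_, ?_⟩ <;> omega

theorem DiagClose.refl (x : ℤ × ℤ) : DiagClose x x := by
  simp [DiagClose]

theorem DiagClose.flip {x y : ℤ × ℤ} (h : DiagClose x y) : DiagClose (flip i x) (flip i y) := by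
  simp only [DiagClose, WhiteDensity.flip] at *
  omega

/-- Congruence modulo the lattice of the tiling. -/
def LatticeEq (α β i : ℕ) (x y : ℤ × ℤ) : Prop :=
  ((4 * α * β - 2 * i : ℕ) : ℤ) ∣
    ((2 * β + 1 : ℤ) * x.1 + (2 * β - 1 : ℤ) * x.2) - ((2 * β + 1 : ℤ) * y.1 + (2 * β - 1 : ℤ) * y.2)

theorem LatticeEq.flip {x y : ℤ × ℤ} (h : LatticeEq α β i x y) :
    LatticeEq α β i (flip i x) (flip i y) := by
  refine (dvd_neg.2 h).trans (dvd_of_eq ?_)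
  simp only [WhiteDensity.flip]
  ring

theorem modulus_cast (hα : 1 ≤ α) (hi : i < β) :
    ((4 * α * β - 2 * i : ℕ) : ℤ) = 2 * (2 * (α * β) - i) := by
  have : 2 * i ≤ 4 * α * β := by nlinarith
  push_cast [this]
  ring

/-- In terms of `u = x + y` and `v = x - y` the functional is `2 β u + v` and the modulus is even,
so the difference in `v` is even, and that in `u` too by parity. -/
theorem LatticeEq.exists_half (hα : 1 ≤ α) (hi : i < β) {x y : ℤ × ℤ}
    (h : LatticeEq α β i x y) : ∃ U V l : ℤ, (x.1 + x.2) - (y.1 + y.2) = 2 * U ∧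
      (x.1 - x.2) - (y.1 - y.2) = 2 * V ∧ 2 * β * U + V = (2 * (α * β) - i) * l := by
  rw [LatticeEq, modulus_cast hα hi] at h
  obtain ⟨l, hl⟩ := h
  obtain ⟨u, hu⟩ : ∃ u, u = (x.1 + x.2) - (y.1 + y.2) := ⟨_, rfl⟩
  obtain ⟨v, hv⟩ : ∃ v, v = (x.1 - x.2) - (y.1 - y.2) := ⟨_, rfl⟩
  have h1 : 2 * (β * u) + v = 2 * ((2 * (α * β) - i) * l) := by
    rw [hu, hv, ← mul_assoc 2 _ l, ← hl]; ring
  refine ⟨u / 2, v / 2, l, by omega, by omega, ?_⟩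
  have hu2 : 2 * (u / 2) = u := by omega
  have hv2 : 2 * (v / 2) = v := by omega
  nlinarith

/-- Halving gives `|U| ≤ α - 1` and `|V| ≤ β - 1`, so `|2 β U + V| < 2 α β - i`. Thus the value is
zero, and then `U = V = 0`. -/
theorem eq_of_latticeEq_of_mem (hα : 1 ≤ α) (hi : i < β) {p q z : ℤ × ℤ}
    (hp : p ∈ notchedBox α β i) (hq : q ∈ notchedBox α β i) (hpz : DiagClose p z)
    (h : LatticeEq α β i z q) : z = q := by
  obtain ⟨U, V, l, hU, hV, hl⟩ := h.exists_half hα hi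
  obtain ⟨hp, -⟩ := mem_notchedBox.1 hp
  obtain ⟨hq, -⟩ := mem_notchedBox.1 hq
  obtain ⟨c1, c2⟩ := hpz
  have hU1 : -((α : ℤ) - 1) ≤ U ∧ U ≤ α - 1 := by omega
  have hV1 : -((β : ℤ) - 1) ≤ V ∧ V ≤ β - 1 := by omega
  have hαβ : (β : ℤ) ≤ α * β := by nlinarith
  have hiβ : (i : ℤ) < β := by exact_mod_cast hi
  have hl0 : l = 0 := by
    have u1 : 2 * β * U ≤ 2 * β * (α - 1 : ℤ) := mul_le_mul_of_nonneg_left hU1.2 (by positivity)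
    have u2 : 2 * β * (-((α : ℤ) - 1)) ≤ 2 * β * U :=
      mul_le_mul_of_nonneg_left hU1.1 (by positivity)
    have hN : 0 ≤ 2 * ((α : ℤ) * β) - i := by omega
    have e1 : 2 * β * (α - 1 : ℤ) = 2 * (α * β) - 2 * β := by ring
    have e2 : 2 * β * (-((α : ℤ) - 1)) = 2 * β - 2 * (α * β) := by ring
    have v1 : l < 1 := by
      by_contra! hl2
      have := mul_le_mul_of_nonneg_left hl2 hN
      linarith
    have v2 : -1 < l := by
      by_contra! hl2
      have := mul_le_mul_of_nonneg_left hl2 hN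
      linarith
    omega
  rw [hl0, mul_zero] at hl
  have hU0 : U = 0 := by
    have v1 : U < 1 := by nlinarith
    have v2 : -1 < U := by nlinarith
    omega
  rw [hU0, mul_zero, zero_add] at hl
  ext <;> omega

/-- `flip` sends `(u, v)` to `(-u, 2 (i - 1) - v)` and so preserves the set of removed pixels. The
ranges of `U` and `V` leave only the multiples `0` and `1` of `2 α β - i`. The multiple `1` falls
between the values for `U ≤ α - 1` and for `U ≥ α`; the multiple `0` means `U = V = 0`, which the
notch excludes. -/
theorem not_latticeEq_of_mem_flip (hα : 1 ≤ α) (hi : i < β) {p q z : ℤ × ℤ}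
    (hp : p ∈ notchedBox α β i) (hq : flip i q ∈ notchedBox α β i) (hpz : DiagClose p z) :
    ¬LatticeEq α β i z q := by
  intro h
  obtain ⟨U, V, l, hU, hV, hl⟩ := h.exists_half hα hi
  obtain ⟨hp, hp0⟩ := mem_notchedBox.1 hp
  obtain ⟨hq, hq0⟩ := mem_notchedBox.1 hq
  simp only [flip] at hq hq0
  obtain ⟨c1, c2⟩ := hpz
  have hU1 : 0 ≤ U ∧ U ≤ 2 * α - 2 := by omega
  have hV1 : 1 - (i : ℤ) ≤ V ∧ V ≤ 2 * β - 1 - i := by omega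
  have hαβ : (β : ℤ) ≤ α * β := by nlinarith
  have hiβ : (i : ℤ) < β := by exact_mod_cast hi
  have u1 : 2 * β * U ≤ 2 * β * (2 * α - 2 : ℤ) := mul_le_mul_of_nonneg_left hU1.2 (by positivity)
  have u2 : 0 ≤ 2 * β * U := mul_nonneg (by positivity) hU1.1
  have hN : 0 ≤ 2 * ((α : ℤ) * β) - i := by omega
  have e1 : 2 * β * (2 * α - 2 : ℤ) = 4 * (α * β) - 4 * β := by ring
  have v1 : l < 2 := by
    by_contra! hl2
    have := mul_le_mul_of_nonneg_left hl2 hN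
    linarith
  have v2 : -1 < l := by
    by_contra! hl2
    have := mul_le_mul_of_nonneg_left hl2 hN
    linarith
  rcases (show l = 0 ∨ l = 1 by omega) with rfl | rfl
  · rw [mul_zero] at hl
    have hU0 : U = 0 := by
      have : U < 1 := by
        by_contra! h1
        have := mul_le_mul_of_nonneg_left h1 (show (0 : ℤ) ≤ 2 * β by positivity)
        linarith
      omega
    rw [hU0, mul_zero, zero_add] at hl
    omega
  · rcases (show U ≤ α - 1 ∨ (α : ℤ) ≤ U by omega) with h | h
    · have := mul_le_mul_of_nonneg_left h (show (0 : ℤ) ≤ 2 * β by positivity)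
      linarith
    · have := mul_le_mul_of_nonneg_left h (show (0 : ℤ) ≤ 2 * β by positivity)
      linarith

/-- The notched boxes and their reflections tile, without loss. -/
theorem le_Phi4_of_notchedBox {j k : ℕ} (hα : 1 ≤ α) (hi : i < β)
    (hj : (j : ℤ) = α * β + (α - 1) * (β - 1) - i) (hk : 1 ≤ k) (hjk : j ≤ k) :
    (j : ℝ) / (j + (α + β - 1)) ≤ Phi4 k := by
  set C := notchedBox α β i with hC
  set T := C ∪ C.image (flip i) with hT
  have hcard : C.card = j := by
    have := card_notchedBox hα hi
    rw [← hj] at this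
    exact_mod_cast this
  have hcard' : (C.image (flip i)).card = j := by
    rw [Finset.card_image_of_injective _ (flip_injective i), hcard]
  have hnot : ∀ p q z, p ∈ C.image (flip i) → q ∈ C → DiagClose p z → ¬LatticeEq α β i z q := by
    intro p q z hp hq hpz h
    exact not_latticeEq_of_mem_flip hα hi (mem_image_flip.1 hp)
      (by rwa [flip_flip]) hpz.flip h.flip
  have heq : ∀ p q z, p ∈ C.image (flip i) → q ∈ C.image (flip i) → DiagClose p z →
      LatticeEq α β i z q → z = q := by
    intro p q z hp hq hpz h
    exact flip_injective i (eq_of_latticeEq_of_mem hα hi (mem_image_flip.1 hp)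
      (mem_image_flip.1 hq) hpz.flip h.flip)
  have hTcard : T.card = 2 * j := by
    rw [hT, Finset.card_union_of_disjoint, hcard, hcard', two_mul]
    rw [Finset.disjoint_left]
    intro x hx hx'
    exact hnot x x x hx' hx (DiagClose.refl x) (by simp [LatticeEq])
  have hM := modulus_cast hα hi
  have hαβ : (β : ℤ) ≤ α * β := by nlinarith
  have hM0 : 0 < 4 * α * β - 2 * i := by
    have : (0 : ℤ) < ((4 * α * β - 2 * i : ℕ) : ℤ) := by rw [hM]; omega
    exact_mod_cast this
  have hval : (j : ℝ) / (j + (α + β - 1)) = (T.card : ℝ) / (4 * α * β - 2 * i : ℕ) := by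
    -- Half of the modulus is `2 α β - i = j + α + β - 1`.
    have e1 : (((4 * α * β - 2 * i : ℕ) : ℤ) : ℝ) = 2 * ((j : ℤ) + (α + β - 1) : ℝ) := by
      rw [hM]
      have hj' : ((j : ℤ) : ℝ) = α * β + (α - 1) * (β - 1) - i := by rw [hj]; push_cast; ring
      rw [hj']
      push_cast
      ring
    rw [Int.cast_natCast, Int.cast_natCast] at e1
    rw [e1, hTcard]
    push_cast
    rw [mul_div_mul_left _ _ (by norm_num : (2 : ℝ) ≠ 0)]
  rw [hval]
  refine (le_density_latticeImage (a := 2 * β + 1) (b := 2 * β - 1) (X := 1 - β) (Y := β) hM0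
    (by ring) ?_).trans (le_Phi (fun I => density_le_F4 hk) ?_)
  · intro p hp q hq (hdvd : LatticeEq α β i p q)
    rcases Finset.mem_union.1 hp with hp | hp <;> rcases Finset.mem_union.1 hq with hq | hq
    · exact eq_of_latticeEq_of_mem hα hi hp hq (DiagClose.refl p) hdvd
    · exact absurd hdvd (not_latticeEq_of_mem_flip hα hi hp (mem_image_flip.1 hq) (DiagClose.refl p))
    · exact absurd hdvd (hnot p q p hp hq (DiagClose.refl p))
    · exact heq p q p hp hq (DiagClose.refl p) hdvd
  · refine whiteComponentsLE_latticeImage grid4_adj_sub fun p hp => ?_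
    rcases Finset.mem_union.1 hp with hp | hp
    · refine ⟨C, hp, hcard.le.trans hjk, ?_⟩
      intro p' hp' z hz q hq (hdvd : LatticeEq α β i z q)
      rcases Finset.mem_union.1 hq with hq | hq
      · rwa [eq_of_latticeEq_of_mem hα hi hp' hq (diagClose_of_adj hz) hdvd]
      · exact absurd hdvd
          (not_latticeEq_of_mem_flip hα hi hp' (mem_image_flip.1 hq) (diagClose_of_adj hz))
    · refine ⟨C.image (flip i), hp, hcard'.le.trans hjk, ?_⟩
      intro p' hp' z hz q hq (hdvd : LatticeEq α β i z q)
      rcases Finset.mem_union.1 hq with hq | hq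
      · exact absurd hdvd (hnot p' q z hp' hq (diagClose_of_adj hz))
      · rwa [heq p' q z hp' hq (diagClose_of_adj hz) hdvd]

end NotchedBox

/-! ### Where `F4` is attained for `k` in `𝒮` -/

section CeilSqrt

variable {j : ℕ}

theorem ceil_two_mul_sqrt_le_of_sq {n : ℕ} (h : 8 * j ≤ n ^ 2 + 4) :
    ⌈2 * Real.sqrt (2 * (j : ℝ) - 1)⌉ ≤ (n : ℤ) := by
  rw [Int.ceil_le]
  have h1 : Real.sqrt (2 * (j : ℝ) - 1) ≤ n / 2 := by
    rw [Real.sqrt_le_iff]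
    refine ⟨by positivity, ?_⟩
    have : (8 * (j : ℝ)) ≤ n ^ 2 + 4 := by exact_mod_cast h
    rw [div_pow]
    linarith
  push_cast
  linarith

/-- Together with `two_le_ceil`, this is all that the maximisation of `F4` uses about the ceiling.
-/
theorem eight_mul_le_ceil_sq :
    8 * (j : ℤ) ≤ ⌈2 * Real.sqrt (2 * (j : ℝ) - 1)⌉ ^ 2 + 4 := by
  have h1 := Int.le_ceil (2 * Real.sqrt (2 * (j : ℝ) - 1))
  set t := ⌈2 * Real.sqrt (2 * (j : ℝ) - 1)⌉
  have h0 : 0 ≤ Real.sqrt (2 * (j : ℝ) - 1) := Real.sqrt_nonneg _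
  have h2 : 2 * (j : ℝ) - 1 ≤ Real.sqrt (2 * (j : ℝ) - 1) ^ 2 := by
    rcases le_total 0 (2 * (j : ℝ) - 1) with h | h
    · exact (Real.sq_sqrt h).ge
    · exact h.trans (sq_nonneg _)
  have h3 : 8 * (j : ℝ) ≤ t ^ 2 + 4 := by nlinarith
  exact_mod_cast h3

theorem two_le_ceil (hj : 1 ≤ j) : 2 ≤ ⌈2 * Real.sqrt (2 * (j : ℝ) - 1)⌉ := by
  have h0 : (1 : ℝ) ≤ j := by exact_mod_cast hj
  have h1 : 1 ≤ Real.sqrt (2 * (j : ℝ) - 1) := Real.one_le_sqrt.2 (by linarith)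
  have h2 := Int.le_ceil (2 * Real.sqrt (2 * (j : ℝ) - 1))
  have h3 : ((2 : ℤ) : ℝ) ≤ ⌈2 * Real.sqrt (2 * (j : ℝ) - 1)⌉ := by push_cast; linarith
  exact_mod_cast h3

end CeilSqrt

theorem F4_le_of_forall {k j₀ : ℕ} {τ : ℤ} (hk : 1 ≤ k) (hj₀ : 1 ≤ j₀) (hτ : 1 ≤ τ) {θ : ℝ}
    (hθ : (j₀ : ℝ) / (j₀ + τ) ≤ θ)
    (h : ∀ j t : ℤ, 1 ≤ j → j ≤ k → 2 ≤ t → 8 * j ≤ t ^ 2 + 4 → j * (2 * τ) ≤ j₀ * t) :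
    F4 k hk ≤ θ := by
  refine Finset.sup'_le _ _ fun j hj => le_trans ?_ hθ
  obtain ⟨hj1, hjk⟩ := Finset.mem_Icc.1 hj
  have h1 := h j _ (by exact_mod_cast hj1) (by exact_mod_cast hjk) (two_le_ceil hj1)
    eight_mul_le_ceil_sq
  have h2 : (j : ℝ) * (2 * τ) ≤ j₀ * (⌈2 * Real.sqrt (2 * (j : ℝ) - 1)⌉ : ℝ) := by
    exact_mod_cast h1
  have hj0 : (0 : ℝ) < j := by exact_mod_cast hj1
  have hj₀0 : (0 : ℝ) < j₀ := by exact_mod_cast hj₀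
  have hτ0 : (0 : ℝ) < τ := by exact_mod_cast hτ
  have h3 := ceil_two_mul_sqrt_nonneg (2 * (j : ℝ) - 1)
  rw [div_le_div_iff₀ (by positivity) (by positivity)]
  linarith

/-- The comparison of `j` with `j₀ = min k s₀(n)`, where `t` stands for the ceiling. The upper end
of the interval for `k` is used for `t ≥ 4n - 1`, the lower end for `t = 4n - 3`. At `t = 4n - 2`
one has `j ≤ j₀`, and smaller `t` are far from optimal. -/
theorem mul_le_mul_near_s0 {n k j₀ j t : ℤ} (hn : 1 ≤ n)
    (hk2 : 2 * k ≤ 2 * (2 * n ^ 2 - 2 * n + 1) + (n - 1))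
    (hj₀ : 2 * (2 * n ^ 2 - 2 * n + 1) - n ≤ 2 * j₀)
    (hj₀' : j₀ = k ∨ (j₀ = 2 * n ^ 2 - 2 * n + 1 ∧ j₀ ≤ k)) (hjk : j ≤ k) (ht : 2 ≤ t)
    (hjt : 8 * j ≤ t ^ 2 + 4) : j * (2 * (2 * n - 1)) ≤ j₀ * t := by
  have hj₀0 : 0 ≤ j₀ := by nlinarith
  rcases (show 4 * n - 1 ≤ t ∨ t = 4 * n - 2 ∨ t = 4 * n - 3 ∨ t ≤ 4 * n - 4 by omega) with
    h | h | h | h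
  · have h1 : j₀ * (4 * n - 1) ≤ j₀ * t := mul_le_mul_of_nonneg_left h hj₀0
    have h2 : j * (2 * (2 * n - 1)) ≤ k * (2 * (2 * n - 1)) :=
      mul_le_mul_of_nonneg_right hjk (by omega)
    rcases hj₀' with h3 | ⟨h3, -⟩
    · rw [h3] at h1 hj₀0 ⊢
      nlinarith
    · have h4 : 2 * k * (2 * (2 * n - 1)) ≤
          (2 * (2 * n ^ 2 - 2 * n + 1) + (n - 1)) * (2 * (2 * n - 1)) :=
        mul_le_mul_of_nonneg_right hk2 (by omega)
      rw [h3] at h1 ⊢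
      nlinarith
  · have hjs : j ≤ 2 * n ^ 2 - 2 * n + 1 := by
      rw [h] at hjt
      nlinarith
    have hjj : j ≤ j₀ := by
      rcases hj₀' with h3 | ⟨h3, -⟩ <;> omega
    rw [h, show 4 * n - 2 = 2 * (2 * n - 1) by ring]
    exact mul_le_mul_of_nonneg_right hjj (by omega)
  · have hjs : j ≤ 2 * n ^ 2 - 3 * n + 1 := by
      have : 8 * j ≤ 8 * (2 * n ^ 2 - 3 * n + 1) + 5 := by
        rw [h] at hjt
        nlinarith
      omega
    have h1 := mul_le_mul_of_nonneg_right hjs (show 0 ≤ 2 * (2 * n - 1) by omega)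
    have h2 := mul_le_mul_of_nonneg_right hj₀ (show 0 ≤ 4 * n - 3 by omega)
    rw [h]
    nlinarith
  · have h1 : (t ^ 2 + 4) * (2 * n - 1) ≤ 2 * (4 * n ^ 2 - 5 * n + 2) * t := by
      have a1 := mul_nonneg (mul_nonneg (show 0 ≤ t - 2 by omega) (show 0 ≤ 4 * n - 4 - t by omega))
        (show 0 ≤ 2 * n - 1 by omega)
      have a2 := mul_nonneg (show 0 ≤ n - 1 by omega) (show 0 ≤ 4 * n - 4 - t by omega)
      have a3 := mul_nonneg (show 0 ≤ n by omega) (show 0 ≤ n - 2 by omega)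
      nlinarith
    have h2 := mul_le_mul_of_nonneg_right hj₀ (show 0 ≤ t by omega)
    have h3 := mul_le_mul_of_nonneg_right hjt (show 0 ≤ 2 * n - 1 by omega)
    nlinarith

/-- The same case distinction around `t = 4n`. -/
theorem mul_le_mul_near_s2 {n k j₀ j t : ℤ} (hn : 1 ≤ n)
    (hk2 : 2 * k ≤ 2 * (2 * n ^ 2) + n) (hj₀ : 2 * (2 * n ^ 2) - n ≤ 2 * j₀)
    (hj₀' : j₀ = k ∨ (j₀ = 2 * n ^ 2 ∧ j₀ ≤ k)) (hjk : j ≤ k) (ht : 2 ≤ t)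
    (hjt : 8 * j ≤ t ^ 2 + 4) : j * (2 * (2 * n)) ≤ j₀ * t := by
  have hj₀0 : 0 ≤ j₀ := by nlinarith
  rcases (show 4 * n + 1 ≤ t ∨ t = 4 * n ∨ t = 4 * n - 1 ∨ t ≤ 4 * n - 2 by omega) with
    h | h | h | h
  · have h1 : j₀ * (4 * n + 1) ≤ j₀ * t := mul_le_mul_of_nonneg_left h hj₀0
    have h2 : j * (2 * (2 * n)) ≤ k * (2 * (2 * n)) := mul_le_mul_of_nonneg_right hjk (by omega)
    rcases hj₀' with h3 | ⟨h3, -⟩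
    · rw [h3] at h1 hj₀0 ⊢
      nlinarith
    · have h4 := mul_le_mul_of_nonneg_right hk2 (show 0 ≤ 2 * (2 * n) by omega)
      rw [h3] at h1 ⊢
      nlinarith
  · have hjs : j ≤ 2 * n ^ 2 := by
      have : 8 * j ≤ 8 * (2 * n ^ 2) + 4 := by
        rw [h] at hjt
        nlinarith
      omega
    have hjj : j ≤ j₀ := by
      rcases hj₀' with h3 | ⟨h3, -⟩ <;> omega
    rw [h, show 4 * n = 2 * (2 * n) by ring]
    exact mul_le_mul_of_nonneg_right hjj (by omega)
  · have hjs : j ≤ 2 * n ^ 2 - n := by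
      have : 8 * j ≤ 8 * (2 * n ^ 2 - n) + 5 := by
        rw [h] at hjt
        nlinarith
      omega
    have h1 := mul_le_mul_of_nonneg_right hjs (show 0 ≤ 2 * (2 * n) by omega)
    have h2 := mul_le_mul_of_nonneg_right hj₀ (show 0 ≤ 4 * n - 1 by omega)
    rw [h]
    nlinarith
  · rcases (show n = 1 ∨ 2 ≤ n by omega) with rfl | hn2
    · have ht2 : t = 2 := by omega
      rw [ht2] at hjt ⊢
      omega
    · have h1 : t ^ 2 + 4 ≤ (4 * n - 1) * t := by
        have a1 := mul_nonneg (show 0 ≤ t - 2 by omega) (show 0 ≤ 4 * n - 2 - t by omega)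
        nlinarith
      have h2 := mul_le_mul_of_nonneg_right hj₀ (show 0 ≤ t by omega)
      have h3 := mul_le_mul_of_nonneg_right (hjt.trans h1) (show 0 ≤ n by omega)
      nlinarith

/-- The tile is the notched box with `α = β = n`, of size `s₀(n) - i`. The notch `i = s - j₀` is at
most `n / 2`, hence less than `β`. Near `s₂(n)` the choice is `α = n`, `β = n + 1`. -/
theorem Phi4_eq_near_s0 {n k : ℕ} (hn : 1 ≤ n) (hk : 1 ≤ k)
    (hk1 : 2 * (2 * (n : ℤ) ^ 2 - 2 * n + 1) - n ≤ 2 * k)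
    (hk2 : 2 * (k : ℤ) ≤ 2 * (2 * (n : ℤ) ^ 2 - 2 * n + 1) + (n - 1)) : Phi4 k = F4 k hk := by
  refine le_antisymm (Phi_le fun I => density_le_F4 hk) ?_
  have hs : (1 : ℤ) ≤ 2 * (n : ℤ) ^ 2 - 2 * n + 1 := by nlinarith
  obtain ⟨s, hs'⟩ := Int.eq_ofNat_of_zero_le (show 0 ≤ 2 * (n : ℤ) ^ 2 - 2 * n + 1 by omega)
  set j₀ := min k s with hj₀
  have hτ : ((2 * n - 1 : ℤ) : ℝ) = (n : ℝ) + n - 1 := by push_cast; ring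
  refine F4_le_of_forall (j₀ := j₀) (τ := 2 * n - 1) hk (by omega) (by omega) ?_ ?_
  · rw [hτ]
    refine le_Phi4_of_notchedBox (α := n) (β := n) (i := s - j₀) hn (by omega) ?_ hk (by omega)
    have : ((s - j₀ : ℕ) : ℤ) = s - j₀ := by omega
    rw [this, ← hs']
    ring
  · intro j t _ hjk ht hjt
    exact mul_le_mul_near_s0 (k := k) (by omega) hk2 (by omega) (by omega) hjk ht hjt

theorem Phi4_eq_near_s2 {n k : ℕ} (hn : 1 ≤ n) (hk : 1 ≤ k)
    (hk1 : 2 * (2 * (n : ℤ) ^ 2) - n ≤ 2 * k)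
    (hk2 : 2 * (k : ℤ) ≤ 2 * (2 * (n : ℤ) ^ 2) + n) : Phi4 k = F4 k hk := by
  refine le_antisymm (Phi_le fun I => density_le_F4 hk) ?_
  have hs : (1 : ℤ) ≤ 2 * (n : ℤ) ^ 2 := by nlinarith
  obtain ⟨s, hs'⟩ := Int.eq_ofNat_of_zero_le (show 0 ≤ 2 * (n : ℤ) ^ 2 by omega)
  set j₀ := min k s with hj₀
  have hτ : ((2 * n : ℤ) : ℝ) = (n : ℝ) + (n + 1 : ℕ) - 1 := by push_cast; ring
  refine F4_le_of_forall (j₀ := j₀) (τ := 2 * n) hk (by omega) (by omega) ?_ ?_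
  · rw [hτ]
    refine le_Phi4_of_notchedBox (α := n) (β := n + 1) (i := s - j₀) hn (by omega) ?_ hk (by omega)
    have : ((s - j₀ : ℕ) : ℤ) = s - j₀ := by omega
    rw [this, ← hs']
    push_cast
    ring
  · intro j t _ hjk ht hjt
    exact mul_le_mul_near_s2 (k := k) (by omega) hk2 (by omega) (by omega) hjk ht hjt

theorem Phi4_eq_of_mem_setS {k : ℕ} (hk : 1 ≤ k) (hS : k ∈ setS) : Phi4 k = F4 k hk := by
  obtain ⟨-, n, hn, h | h⟩ := hS
  · simp only [s0, Set.mem_Icc] at h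
    refine Phi4_eq_near_s0 hn hk ?_ ?_
    · have : 2 * (2 * (n : ℝ) ^ 2 - 2 * n + 1) - n ≤ 2 * k := by nlinarith [h.1]
      exact_mod_cast this
    · have : 2 * (k : ℝ) ≤ 2 * (2 * (n : ℝ) ^ 2 - 2 * n + 1) + (n - 1) := by nlinarith [h.2]
      exact_mod_cast this
  · simp only [s2, Set.mem_Icc] at h
    refine Phi4_eq_near_s2 hn hk ?_ ?_
    · have : 2 * (2 * (n : ℝ) ^ 2) - n ≤ 2 * k := by linarith [h.1]
      exact_mod_cast this
    · have : 2 * (k : ℝ) ≤ 2 * (2 * (n : ℝ) ^ 2) + n := by linarith [h.2]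
      exact_mod_cast this

/-! ### Strict inequality for `k` in `𝒰` -/

theorem Phi4_lt_of_sides {e o s k : ℕ} (he : 2 ≤ e) (heven : Even e) (ho : 3 ≤ o)
    (heo : o = e + 1 ∨ e = o + 1) (hs : 2 * s = e * o)
    (hk : k * (e + o) < s * (e + o + 1)) (hsk : s ≤ k) (hk1 : 1 ≤ k) : Phi4 k < F4 k hk1 := by
  obtain ⟨θ, hθ, h⟩ := exists_lt_forall_density_le he heven ho heo hs hk hk1
  refine (Phi_le h).trans_lt (hθ.trans_le ?_)
  have hs1 : 1 ≤ s := by nlinarith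
  refine le_trans ?_ (le_F4 hs1 hsk)
  have h1 : ⌈2 * Real.sqrt (2 * (s : ℝ) - 1)⌉ ≤ ((e + o : ℕ) : ℤ) := by
    refine ceil_two_mul_sqrt_le_of_sq ?_
    rcases heo with rfl | rfl <;> nlinarith
  have h2 : (⌈2 * Real.sqrt (2 * (s : ℝ) - 1)⌉ : ℝ) ≤ e + o := by exact_mod_cast h1
  have hs0 : (0 : ℝ) < s := by exact_mod_cast hs1
  have h3 := ceil_two_mul_sqrt_nonneg (2 * (s : ℝ) - 1)
  rw [div_le_div_iff₀ (by positivity) (by positivity)]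
  nlinarith

theorem Phi4_lt_of_mem_setU {k : ℕ} (hk : 1 ≤ k) (hU : k ∈ setU) : Phi4 k < F4 k hk := by
  obtain ⟨hk2, n, hn, h | h⟩ := hU
  · simp only [s1, Set.mem_Icc] at h
    have h1 : (n : ℤ) * (2 * n - 1) ≤ k := by exact_mod_cast h.1
    have h2 : 2 * (k : ℤ) ≤ 2 * (n * (2 * n - 1)) + (n - 1) := by
      have : 2 * (k : ℝ) ≤ 2 * (n * (2 * n - 1)) + (n - 1) := by linarith [h.2]
      exact_mod_cast this
    -- For `n = 1` the interval is `{1}`, which `k ≥ 2` excludes.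
    have hn2 : 2 ≤ n := by
      by_contra hlt
      obtain rfl : n = 1 := by omega
      norm_num at h2
      omega
    obtain ⟨m, rfl⟩ := Nat.exists_eq_add_of_le hn2
    have c1 : ((2 + m : ℕ) : ℤ) * (2 * (2 + m : ℕ) - 1) = (((2 + m) * (2 * m + 3) : ℕ) : ℤ) := by
      push_cast; ring
    rw [c1] at h1 h2
    refine Phi4_lt_of_sides (e := 2 * (2 + m)) (o := 2 * m + 3) (s := (2 + m) * (2 * m + 3))
      (by omega) (even_two_mul _) (by omega) (by omega) (by ring) ?_ (by exact_mod_cast h1) hk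
    have h3 : 2 * k ≤ 2 * ((2 + m) * (2 * m + 3)) + (m + 1) := by
      have : (2 * k : ℤ) ≤ 2 * (((2 + m) * (2 * m + 3) : ℕ) : ℤ) + (m + 1) := by
        refine h2.trans (le_of_eq ?_)
        push_cast; ring
      exact_mod_cast this
    nlinarith
  · simp only [s3, Set.mem_Icc] at h
    have h1 : n * (2 * n + 1) ≤ k := by exact_mod_cast h.1
    have h2 : 2 * k ≤ 2 * (n * (2 * n + 1)) + n := by
      have : 2 * (k : ℝ) ≤ 2 * (n * (2 * n + 1)) + n := by linarith [h.2]
      exact_mod_cast this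
    refine Phi4_lt_of_sides (e := 2 * n) (o := 2 * n + 1) (s := n * (2 * n + 1))
      (by omega) (even_two_mul _) (by omega) (by omega) (by ring) ?_ h1 hk
    nlinarith

/-! ### The natural density of `𝒮` -/

section NaturalDensity

/-- The two intervals of `setS` belonging to the index `n + 1`. -/
def setSBlock (n : ℕ) : Finset ℕ :=
  Finset.Icc (2 * n ^ 2 + 2 * n + 1 - (n + 1) / 2) (2 * n ^ 2 + 2 * n + 1 + n / 2) ∪
    Finset.Icc (2 * n ^ 2 + 4 * n + 2 - (n + 1) / 2) (2 * n ^ 2 + 4 * n + 2 + (n + 1) / 2)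

theorem mem_setS_iff {k : ℕ} : k ∈ setS ↔ ∃ n, k ∈ setSBlock n := by
  have key : ∀ n : ℕ, (((k : ℝ) ∈ Set.Icc (s0 (n + 1) - ((n + 1 : ℕ) : ℝ) / 2)
      (s0 (n + 1) + (((n + 1 : ℕ) : ℝ) - 1) / 2) ∨
      (k : ℝ) ∈ Set.Icc (s2 (n + 1) - ((n + 1 : ℕ) : ℝ) / 2)
        (s2 (n + 1) + ((n + 1 : ℕ) : ℝ) / 2)) ↔ k ∈ setSBlock n) := by
    intro n
    have c : ∀ a b : ℕ, (a : ℝ) ≤ b ↔ a ≤ b := fun a b => Nat.cast_le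
    have e1 : s0 (n + 1) - ((n + 1 : ℕ) : ℝ) / 2 ≤ k ↔
        2 * (2 * n ^ 2 + 2 * n + 1) ≤ 2 * k + (n + 1) := by
      rw [← c, s0]; push_cast
      constructor <;> intro h <;> nlinarith
    have e2 : (k : ℝ) ≤ s0 (n + 1) + (((n + 1 : ℕ) : ℝ) - 1) / 2 ↔
        2 * k ≤ 2 * (2 * n ^ 2 + 2 * n + 1) + n := by
      rw [← c, s0]; push_cast
      constructor <;> intro h <;> nlinarith
    have e3 : s2 (n + 1) - ((n + 1 : ℕ) : ℝ) / 2 ≤ k ↔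
        2 * (2 * n ^ 2 + 4 * n + 2) ≤ 2 * k + (n + 1) := by
      rw [← c, s2]; push_cast
      constructor <;> intro h <;> nlinarith
    have e4 : (k : ℝ) ≤ s2 (n + 1) + ((n + 1 : ℕ) : ℝ) / 2 ↔
        2 * k ≤ 2 * (2 * n ^ 2 + 4 * n + 2) + (n + 1) := by
      rw [← c, s2]; push_cast
      constructor <;> intro h <;> nlinarith
    rw [Set.mem_Icc, Set.mem_Icc, e1, e2, e3, e4, setSBlock, Finset.mem_union, Finset.mem_Icc,
      Finset.mem_Icc]
    omega
  constructor
  · rintro ⟨-, n, hn, h⟩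
    obtain ⟨m, rfl⟩ := Nat.exists_eq_add_of_le' hn
    exact ⟨m, (key m).1 h⟩
  · rintro ⟨n, h⟩
    refine ⟨?_, n + 1, by omega, (key n).2 h⟩
    rw [setSBlock, Finset.mem_union, Finset.mem_Icc, Finset.mem_Icc] at h
    omega

/-- The numbers `2 n² + n` separate the blocks. Consecutive ones differ by `4n + 3`, about twice the
size of the block between them. -/
theorem lt_and_le_of_mem_setSBlock {n k : ℕ} (h : k ∈ setSBlock n) :
    2 * n ^ 2 + n < k ∧ k ≤ 2 * (n + 1) ^ 2 + (n + 1) := by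
  rw [setSBlock, Finset.mem_union, Finset.mem_Icc, Finset.mem_Icc] at h
  have e : 2 * (n + 1) ^ 2 + (n + 1) = 2 * n ^ 2 + 5 * n + 3 := by ring
  rw [e]
  omega

theorem card_setSBlock (n : ℕ) :
    2 * n + 2 ≤ (setSBlock n).card ∧ (setSBlock n).card ≤ 2 * n + 3 := by
  rw [setSBlock, Finset.card_union_of_disjoint, Nat.card_Icc, Nat.card_Icc]
  · omega
  · rw [Finset.disjoint_left]
    intro k h1 h2
    rw [Finset.mem_Icc] at h1 h2
    omega

theorem boundary_mono {m n : ℕ} (h : m ≤ n) : 2 * m ^ 2 + m ≤ 2 * n ^ 2 + n := by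
  nlinarith [Nat.pow_le_pow_left h 2]

open Classical in
theorem card_filter_setS_boundary (n : ℕ) :
    n ^ 2 + n ≤ ((Finset.Icc 1 (2 * n ^ 2 + n)).filter (· ∈ setS)).card ∧
      ((Finset.Icc 1 (2 * n ^ 2 + n)).filter (· ∈ setS)).card ≤ n ^ 2 + 2 * n := by
  induction n with
  | zero => simp
  | succ n ih =>
    have hstep : (Finset.Icc 1 (2 * (n + 1) ^ 2 + (n + 1))).filter (· ∈ setS) =
        (Finset.Icc 1 (2 * n ^ 2 + n)).filter (· ∈ setS) ∪ setSBlock n := by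
      ext k
      simp only [Finset.mem_filter, Finset.mem_union, Finset.mem_Icc]
      constructor
      · rintro ⟨⟨h1, h2⟩, hS⟩
        by_cases hk : k ≤ 2 * n ^ 2 + n
        · exact Or.inl ⟨⟨h1, hk⟩, hS⟩
        · right
          obtain ⟨m, hm⟩ := mem_setS_iff.1 hS
          obtain ⟨g1, g2⟩ := lt_and_le_of_mem_setSBlock hm
          have : m = n := by
            rcases lt_trichotomy m n with h | h | h
            · have := boundary_mono (show m + 1 ≤ n from h)
              omega
            · exact h
            · have := boundary_mono (show n + 1 ≤ m from h)
              omega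
          rwa [← this]
      · rintro (⟨⟨h1, h2⟩, hS⟩ | h)
        · exact ⟨⟨h1, h2.trans (boundary_mono n.le_succ)⟩, hS⟩
        · have := lt_and_le_of_mem_setSBlock h
          exact ⟨⟨by omega, this.2⟩, mem_setS_iff.2 ⟨n, h⟩⟩
    have hdisj : Disjoint ((Finset.Icc 1 (2 * n ^ 2 + n)).filter (· ∈ setS)) (setSBlock n) := by
      rw [Finset.disjoint_left]
      intro k h1 h2
      have h3 := (Finset.mem_Icc.1 (Finset.mem_filter.1 h1).1).2
      have h4 := (lt_and_le_of_mem_setSBlock h2).1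
      omega
    rw [hstep, Finset.card_union_of_disjoint hdisj]
    have := card_setSBlock n
    have e : (n + 1) ^ 2 = n ^ 2 + 2 * n + 1 := by ring
    rw [e]
    omega

theorem exists_boundary (N : ℕ) :
    ∃ n, 2 * n ^ 2 + n ≤ N ∧ N < 2 * (n + 1) ^ 2 + (n + 1) := by
  induction N with
  | zero => exact ⟨0, by simp⟩
  | succ N ih =>
    obtain ⟨n, h1, h2⟩ := ih
    by_cases h : N + 1 < 2 * (n + 1) ^ 2 + (n + 1)
    · exact ⟨n, by omega, h⟩
    · refine ⟨n + 1, by omega, ?_⟩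
      nlinarith

/-- For `N` between consecutive boundaries the count is squeezed between `n² + n` and `(n + 1)² + 2
(n + 1)`, so it differs from `N / 2` by `O(n)`, where `n ≤ √N`. -/
theorem abs_ncard_setS_sub_le {N : ℕ} (hN : 1 ≤ N) :
    |((setS ∩ Set.Icc 1 N).ncard : ℝ) / N - 1 / 2| ≤ 7 / Real.sqrt N := by
  classical
  have hc : (setS ∩ Set.Icc 1 N).ncard = ((Finset.Icc 1 N).filter (· ∈ setS)).card := by
    rw [← Set.ncard_coe_finset]
    congr 1
    ext k
    simp only [Finset.coe_filter, Set.mem_inter_iff, Set.mem_Icc, Finset.mem_Icc,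
      Set.mem_ofPred_eq]
    tauto
  rw [hc]
  obtain ⟨n, h1, h2⟩ := exists_boundary N
  set c := ((Finset.Icc 1 N).filter (· ∈ setS)).card with hcdef
  have h3 : n ^ 2 + n ≤ c := (card_filter_setS_boundary n).1.trans
    (Finset.card_le_card (Finset.filter_subset_filter _ (Finset.Icc_subset_Icc_right h1)))
  have h4 : c ≤ (n + 1) ^ 2 + 2 * (n + 1) := le_trans
    (Finset.card_le_card (Finset.filter_subset_filter _ (Finset.Icc_subset_Icc_right h2.le)))
    (card_filter_setS_boundary (n + 1)).2
  have hn : (n : ℝ) ≤ Real.sqrt N := by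
    refine Real.le_sqrt_of_sq_le ?_
    exact_mod_cast (by omega : n ^ 2 ≤ N)
  have hN1 : (1 : ℝ) ≤ N := by exact_mod_cast hN
  have hsq1 : 1 ≤ Real.sqrt N := Real.one_le_sqrt.2 hN1
  have hsq : Real.sqrt N * Real.sqrt N = N := Real.mul_self_sqrt (by positivity)
  have g1 : (N : ℝ) ≤ 2 * c + 3 * n + 3 := by
    exact_mod_cast (by nlinarith : N ≤ 2 * c + 3 * n + 3)
  have g2 : 2 * (c : ℝ) ≤ N + 7 * n + 6 := by
    exact_mod_cast (by nlinarith : 2 * c ≤ N + 7 * n + 6)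
  have hN0 : (0 : ℝ) < N := by linarith
  have e1 : (c : ℝ) / N - 1 / 2 = (2 * c - N) / (2 * N) := by
    field_simp
  have e2 : 7 / Real.sqrt N = 14 * Real.sqrt N / (2 * N) := by
    rw [div_eq_div_iff (by positivity) (by positivity)]
    linear_combination (-14) * hsq
  rw [e1, e2, abs_div, abs_of_pos (show (0 : ℝ) < 2 * N by positivity)]
  refine div_le_div_of_nonneg_right ?_ (by positivity)
  rw [abs_le]
  constructor <;> linarith

theorem hasNaturalDensity_setS : HasNaturalDensity setS (1 / 2) := by
  have hlim : Filter.Tendsto (fun N : ℕ => 7 / Real.sqrt N) Filter.atTop (nhds 0) :=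
    Filter.Tendsto.div_atTop tendsto_const_nhds
      (Real.tendsto_sqrt_atTop.comp tendsto_natCast_atTop_atTop)
  rw [HasNaturalDensity, tendsto_iff_norm_sub_tendsto_zero]
  refine squeeze_zero' (Filter.Eventually.of_forall fun N => norm_nonneg _) ?_ hlim
  filter_upwards [Filter.eventually_ge_atTop 1] with N hN
  exact abs_ncard_setS_sub_le hN

end NaturalDensity

end WhiteDensity

end

theorem theorem1p1 :
    (∀ (k : ℕ) (hk : 1 ≤ k), WhiteDensity.Phi8 k = WhiteDensity.F8 k hk) ∧
    (∀ (k : ℕ) (hk : 1 ≤ k), WhiteDensity.Phi4 k ≤ WhiteDensity.F4 k hk) ∧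
    (∀ (k : ℕ) (hk : 1 ≤ k), k ∈ WhiteDensity.setS →
      WhiteDensity.Phi4 k = WhiteDensity.F4 k hk) ∧
    (∀ (k : ℕ) (hk : 1 ≤ k), k ∈ WhiteDensity.setU →
      WhiteDensity.Phi4 k < WhiteDensity.F4 k hk) ∧
    WhiteDensity.HasNaturalDensity WhiteDensity.setS (1 / 2) :=
  ⟨fun _ hk => WhiteDensity.Phi8_eq hk,
    fun _ hk => WhiteDensity.Phi_le fun _ => WhiteDensity.density_le_F4 hk,
    fun _ hk hS => WhiteDensity.Phi4_eq_of_mem_setS hk hS,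
    fun _ hk hU => WhiteDensity.Phi4_lt_of_mem_setU hk hU,
    WhiteDensity.hasNaturalDensity_setS⟩
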